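/- Let $\alpha\in[0,1]$. For a finite positive Borel measure $\mu$ on $\mathbb R$ write $\mu=\mu_{\mathrm{ac}}+\mu_{\mathrm{sing}}$ for its Lebesgue decomposition. Let $\chi^\pm\in C^\infty(\mathbb R;[0,1])$ with $\chi^++\chi^-=1$, $\operatorname{supp}\chi^+\subset(-1,\infty)$, $\operatorname{supp}\chi^-\subset(-\infty,1)$, and let $E_2=\{\bar f+a\chi^++b\chi^-:\bar f\in H^1(\mathbb R),\ a,b\in\mathbb R\}$ (continuous representatives), $E_1^0=\{\bar f+a\chi^+:\bar f\in L^2(\mathbb R),\ a\in\mathbb R\}$. **Eulerian coordinates.** $\mathcal D$ is the set of triplets $(u,\mu,\nu)$ with $u\in E_2$; $\mu\le\nu$ finite positive Borel measures on $\mathbb R$ with $\mu_{\mathrm{ac}}\le\nu_{\mathrm{ac}}$; $d\mu_{\mathrm{ac}}=u_x^2\,dx$; $F(x)=\mu((-\infty,x))$ and $G(x)=\nu((-\infty,x))$ in $E_1^0$; if $\alpha=1$, then $d\nu_{\mathrm{ac}}=d\mu=u_x^2\,dx$; if $\alpha<1$, then $\frac{d\mu}{d\nu}\in\{1-\alpha,1\}$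 $\nu$-a.e., and $\frac{d\mu_{\mathrm{ac}}}{d\nu_{\mathrm{ac}}}(x)=1$ for $\nu_{\mathrm{ac}}$-a.e. $x$ with $u_x(x)<0$. $\mathcal D_0$ is the set of those with $\mu=\nu$. Write $F_{\mathrm{ac}}(x)=\mu_{\mathrm{ac}}((-\infty,x))$, $F_{\mathrm{sing}}(x)=\mu_{\mathrm{sing}}((-\infty,x))$, $F_\infty=\mu(\mathbb R)$, $G_\infty=\nu(\mathbb R)$. **Change of coordinates.** $L(u,\mu,\nu)=(y,U,V,H)$ with $y(\xi)=\sup\{x:\nu((-\infty,x))+x<\xi\}$, $U=u\circ y$, $H(\xi)=\xi-y(\xi)$, $V(\xi)=\int_{-\infty}^\xi\frac{d\mu}{d\nu}(y(\eta))H_\xi(\eta)\,d\eta$. Conversely $M(y,U,V,H)=(u,\mu,\nu)$ with $u(x)=U(\xi)$ whenever $x=y(\xi)$, $\mu=y_\#(V_\xi\,d\xi)$, $\nu=y_\#(H_\xi\,d\xi)$. **Evolution.** $S_t(X_0)=(y,U,V,H)(t)$ is the unique solution with initial datum $X_0=(y_0,U_0,V_0,H_0)$ of $$y_t=U,\quad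 U_t=\tfrac12V-\tfrac14V_\infty(t),\quad V(t,\xi)=\int_{-\infty}^\xi V_{0,\xi}(\eta)\bigl(1-\alpha\chi_{\{t\ge\tau(\eta)>0\}}(\eta)\bigr)d\eta,\quad H_t=0,$$ (the differential equations in time being understood in integrated form), where $V_\infty(t)=\lim_{\xi\to\infty}V(t,\xi)$, and $\tau(\xi)=-2y_{0,\xi}(\xi)/U_{0,\xi}(\xi)$ if $U_{0,\xi}(\xi)<0$, $\tau(\xi)=0$ if $y_{0,\xi}(\xi)=U_{0,\xi}(\xi)=0$, and $\tau(\xi)=\infty$ otherwise. Put $T_t=M\circ S_t\circ L$. **Projection.** Let $\Delta x>0$, $x_j=j\Delta x$, $Df_{2j}=\frac{f(x_{2j+2})-f(x_{2j})}{2\Delta x}$, and let $\varepsilon_j\in\{1,-1\}$ $(j\in\mathbb Z)$ be an arbitrary choice of signs. For $(u,\mu,\mu)\in\mathcal D_0$ let $q_{2j}=\sqrt{DF_{\mathrm{ac},2j}-(Du_{2j})^2}$, $s_j^\pm=Du_{2j}\pm\varepsilon_jq_{2j}$, and $P_{\Delta x}(u,\mu,\mu)=(u_{\Delta x},\mu_{\Delta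 x},\mu_{\Delta x})$, where $$u_{\Delta x}(x)=\begin{cases}u(x_{2j})+s_j^-(x-x_{2j}),&x_{2j}<x\le x_{2j+1},\\u(x_{2j+2})+s_j^+(x-x_{2j+2}),&x_{2j+1}<x\le x_{2j+2},\end{cases}$$ and $\mu_{\Delta x}$ is the finite positive measure with $\mu_{\Delta x}((-\infty,x))=F_{\Delta x,\mathrm{ac}}(x)+F_{\mathrm{sing}}(x_{2j+2})$ for $x_{2j}<x\le x_{2j+2}$, where $$F_{\Delta x,\mathrm{ac}}(x)=\begin{cases}F_{\mathrm{ac}}(x_{2j})+(s_j^-)^2(x-x_{2j}),&x_{2j}<x\le x_{2j+1},\\\frac{F_{\mathrm{ac}}(x_{2j+2})+F_{\mathrm{ac}}(x_{2j})}2-2\varepsilon_jq_{2j}Du_{2j}\Delta x+(s_j^+)^2(x-x_{2j+1}),&x_{2j+1}<x\le x_{2j+2}.\end{cases}$$ **Lemma.** Let $(u_0,\mu_0,\nu_0)\in\mathcal D_0$, $\Delta x>0$ and $t\ge0$. Put $(y,U,V,H)(t)=S_t\circ L(u_0,\mu_0,\nu_0)$, $(y_{\Delta x},U_{\Delta x},V_{\Delta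 x},H_{\Delta x})(t)=S_t\circ L\circ P_{\Delta x}(u_0,\mu_0,\nu_0)$, $(u,\mu,\nu)(t)=T_t(u_0,\mu_0,\nu_0)$, $(u_{\Delta x},\mu_{\Delta x},\nu_{\Delta x})(t)=T_t\circ P_{\Delta x}(u_0,\mu_0,\nu_0)$, $G(t,x)=\nu(t)((-\infty,x))$, $G_{\Delta x}(t,x)=\nu_{\Delta x}(t)((-\infty,x))$, $F_\infty(0)=\mu_0(\mathbb R)$ and $G_\infty(0)=\nu_0(\mathbb R)$. Then $U(t)-U_{\Delta x}(t)\in L^\infty(\mathbb R)$, $y(t)-y_{\Delta x}(t)\in L^\infty(\mathbb R)$, $y_\xi(t)-y_{\Delta x,\xi}(t)\in L^2(\mathbb R)$, and $$\|u(t)-u_{\Delta x}(t)\|_\infty\le\|U(t)-U_{\Delta x}(t)\|_\infty+\sqrt{F_\infty(0)}\,\|y(t)-y_{\Delta x}(t)\|_\infty^{1/2},$$ $$\|G(t)-G_{\Delta x}(t)\|_1\le4e^{t/2}G_\infty(0)\Delta x+2G_\infty(0)\|y(t)-y_{\Delta x}(t)\|_\infty+e^{t/4}G_\infty(0)^{3/2}\|y_\xi(t)-y_{\Delta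 x,\xi}(t)\|_2.$$ -/

import Mathlib

open MeasureTheory Set Filter Topology
open scoped ENNReal

noncomputable section

namespace HunterSaxton

/-! ### Function spaces on the real line -/

/-- The Sobolev space `H¹(ℝ)`, every class being represented by its (locally absolutely) continuous
representative: `f ∈ L²` is a primitive of a function in `L²`. -/
def MemH1 (f : ℝ → ℝ) : Prop :=
  MemLp f 2 volume ∧
    ∃ g : ℝ → ℝ, MemLp g 2 volume ∧ ∀ a b : ℝ, f b - f a = ∫ x in a..b, g x

/-- A smooth partition of unity `χ⁺ + χ⁻ = 1` on `ℝ` with `supp χ⁺ ⊆ (-1, ∞)` and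
`supp χ⁻ ⊆ (-∞, 1)`. -/
structure IsPartition (χp χm : ℝ → ℝ) : Prop where
  smooth_p : ContDiff ℝ (⊤ : ℕ∞) χp
  smooth_m : ContDiff ℝ (⊤ : ℕ∞) χm
  sum_eq_one : ∀ x, χp x + χm x = 1
  mem_p : ∀ x, χp x ∈ Icc (0 : ℝ) 1
  mem_m : ∀ x, χm x ∈ Icc (0 : ℝ) 1
  supp_p : tsupport χp ⊆ Ioi (-1)
  supp_m : tsupport χm ⊆ Iio 1

/-- `E₂`: the functions `f̄ + a χ⁺ + b χ⁻` with `f̄ ∈ H¹(ℝ)` and `a, b ∈ ℝ`. The space does not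
depend on the partition of unity. -/
def MemE2 (f : ℝ → ℝ) : Prop :=
  ∃ χp χm : ℝ → ℝ, IsPartition χp χm ∧
    ∃ a b : ℝ, MemH1 (fun x => f x - a * χp x - b * χm x)

/-- `E₁⁰`: the functions `f̄ + a χ⁺` with `f̄ ∈ L²(ℝ)` and `a ∈ ℝ`. -/
def MemE10 (f : ℝ → ℝ) : Prop :=
  ∃ χp χm : ℝ → ℝ, IsPartition χp χm ∧
    ∃ a : ℝ, MemLp (fun x => f x - a * χp x) 2 volume

/-! ### Eulerian coordinates -/

/-- The absolutely continuous part of `μ` with respect to Lebesgue measure. -/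
def acPart (μ : Measure ℝ) : Measure ℝ := volume.withDensity (μ.rnDeriv volume)

/-- The singular part of `μ` with respect to Lebesgue measure. -/
def singPart (μ : Measure ℝ) : Measure ℝ := μ.singularPart volume

/-- The left-continuous primitive `x ↦ μ((-∞, x))`. -/
def prim (μ : Measure ℝ) (x : ℝ) : ℝ := (μ (Iio x)).toReal

/-- The total mass `μ(ℝ)`. -/
def total (μ : Measure ℝ) : ℝ := (μ univ).toReal

/-- A triplet `(u, μ, ν)`. -/
structure Euler where
  u : ℝ → ℝ
  μ : Measure ℝ
  ν : Measure ℝ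

/-- The measure `u_x² dx`; a function in `E₂` is differentiable almost everywhere, with its
pointwise derivative equal to its weak derivative. -/
def energyDensity (u : ℝ → ℝ) : Measure ℝ :=
  volume.withDensity (fun x => ENNReal.ofReal (deriv u x ^ 2))

/-- The set `𝒟` of Eulerian coordinates (for the parameter `α`). -/
structure MemD (α : ℝ) (Z : Euler) : Prop where
  u_mem : MemE2 Z.u
  finite_μ : IsFiniteMeasure Z.μ
  finite_ν : IsFiniteMeasure Z.ν
  μ_le_ν : Z.μ ≤ Z.ν
  ac_le_ac : acPart Z.μ ≤ acPart Z.ν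
  ac_eq : acPart Z.μ = energyDensity Z.u
  F_mem : MemE10 (prim Z.μ)
  G_mem : MemE10 (prim Z.ν)
  dissipative : α = 1 → acPart Z.ν = Z.μ ∧ Z.μ = energyDensity Z.u
  rnDeriv_mem : α < 1 →
    ∀ᵐ x ∂Z.ν, Z.μ.rnDeriv Z.ν x = ENNReal.ofReal (1 - α) ∨ Z.μ.rnDeriv Z.ν x = 1
  rnDeriv_ac : α < 1 →
    ∀ᵐ x ∂(acPart Z.ν), deriv Z.u x < 0 → (acPart Z.μ).rnDeriv (acPart Z.ν) x = 1

/-- The set `𝒟₀` of the elements of `𝒟` with `μ = ν`. -/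
def MemD0 (α : ℝ) (Z : Euler) : Prop := MemD α Z ∧ Z.μ = Z.ν

/-! ### Lagrangian coordinates and the maps between the two sets of coordinates -/

/-- A quadruplet `(y, U, V, H)`. -/
@[ext]
structure Lagr where
  y : ℝ → ℝ
  U : ℝ → ℝ
  V : ℝ → ℝ
  H : ℝ → ℝ

/-- `y(ξ) = sup {x : ν((-∞, x)) + x < ξ}`. -/
def charL (ν : Measure ℝ) (ξ : ℝ) : ℝ := sSup {x : ℝ | prim ν x + x < ξ}

/-- The map `L` from Eulerian to Lagrangian coordinates. -/
def mapL (Z : Euler) : Lagr where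
  y := charL Z.ν
  U := fun ξ => Z.u (charL Z.ν ξ)
  V := fun ξ => ∫ η in Iic ξ,
    (Z.μ.rnDeriv Z.ν (charL Z.ν η)).toReal * deriv (fun ζ => ζ - charL Z.ν ζ) η
  H := fun ξ => ξ - charL Z.ν ξ

/-- The map `M` from Lagrangian to Eulerian coordinates: `u(x) = U(ξ)` for any `ξ` with
`y(ξ) = x`, `μ = y_#(V_ξ dξ)`, `ν = y_#(H_ξ dξ)`. -/
def mapM (X : Lagr) : Euler where
  u := fun x => X.U (Function.invFun X.y x)
  μ := (volume.withDensity (fun ξ => ENNReal.ofReal (deriv X.V ξ))).map X.y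
  ν := (volume.withDensity (fun ξ => ENNReal.ofReal (deriv X.H ξ))).map X.y

/-! ### Time evolution -/

open Classical in
/-- The wave breaking function `τ : ℝ → [0, ∞]` of the initial datum `X₀`. -/
def waveBreak (X₀ : Lagr) (ξ : ℝ) : ℝ≥0∞ :=
  if deriv X₀.U ξ < 0 then ENNReal.ofReal (-(2 * deriv X₀.y ξ) / deriv X₀.U ξ)
  else if deriv X₀.y ξ = 0 ∧ deriv X₀.U ξ = 0 then 0
  else ⊤

open Classical in
/-- `V(t, ξ) = ∫_{-∞}^ξ V_{0,ξ}(η) (1 - α χ_{t ≥ τ(η) > 0}(η)) dη`. -/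
def energyV (α : ℝ) (X₀ : Lagr) (t ξ : ℝ) : ℝ :=
  ∫ η in Iic ξ, deriv X₀.V η *
    (1 - α * (if waveBreak X₀ η ≤ ENNReal.ofReal t ∧ 0 < waveBreak X₀ η then 1 else 0))

/-- `X` solves, for `t ≥ 0`, the system
`y_t = U`, `U_t = V / 2 - V_∞(t) / 4`, `V(t, ξ) = ∫_{-∞}^ξ V_{0,ξ} (1 - α χ_{t ≥ τ > 0}) dη`, `H_t = 0`
with initial datum `X₀`, where `V_∞(t) = lim_{ξ → ∞} V(t, ξ)`. As `V` may jump in time, the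
differential equations are understood in integrated form. -/
structure IsSolution (α : ℝ) (X₀ : Lagr) (X : ℝ → Lagr) : Prop where
  y_eq : ∀ t, 0 ≤ t → ∀ ξ, (X t).y ξ = X₀.y ξ + ∫ s in (0 : ℝ)..t, (X s).U ξ
  U_eq : ∀ t, 0 ≤ t → ∀ ξ, (X t).U ξ = X₀.U ξ +
    ∫ s in (0 : ℝ)..t, (1 / 2 * (X s).V ξ - 1 / 4 * limUnder atTop (X s).V)
  V_eq : ∀ t, 0 ≤ t → ∀ ξ, (X t).V ξ = energyV α X₀ t ξ
  H_eq : ∀ t, 0 ≤ t → ∀ ξ, (X t).H ξ = X₀.H ξ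

/-- `U(t, ξ)`, obtained by integrating its equation in time. -/
def velocityU (α : ℝ) (X₀ : Lagr) (t ξ : ℝ) : ℝ :=
  X₀.U ξ + ∫ s in (0 : ℝ)..t,
    (1 / 2 * energyV α X₀ s ξ - 1 / 4 * limUnder atTop (energyV α X₀ s))

/-- The solution operator `S_t` in Lagrangian coordinates. The system is solved by successive
integration, so the solution can be written down; `isSolution_iff` below shows that it is the
unique solution. -/
def evolve (α : ℝ) (t : ℝ) (X₀ : Lagr) : Lagr where
  y := fun ξ => X₀.y ξ + ∫ s in (0 : ℝ)..t, velocityU α X₀ s ξ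
  U := velocityU α X₀ t
  V := energyV α X₀ t
  H := X₀.H

theorem isSolution_iff (α : ℝ) (X₀ : Lagr) (X : ℝ → Lagr) :
    IsSolution α X₀ X ↔ ∀ t, 0 ≤ t → X t = evolve α t X₀ := by
  constructor
  · intro h
    have hV : ∀ t, 0 ≤ t → (X t).V = energyV α X₀ t := fun t ht => funext (h.V_eq t ht)
    have hU : ∀ t, 0 ≤ t → (X t).U = velocityU α X₀ t := by
      intro t ht
      funext ξ
      rw [h.U_eq t ht ξ, velocityU]
      congr 1
      refine intervalIntegral.integral_congr fun s hs => ?_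
      rw [uIcc_of_le ht] at hs
      simp only [hV s hs.1]
    intro t ht
    refine Lagr.ext ?_ (hU t ht) (hV t ht) (funext (h.H_eq t ht))
    funext ξ
    rw [h.y_eq t ht ξ]
    simp only [evolve]
    congr 1
    refine intervalIntegral.integral_congr fun s hs => ?_
    rw [uIcc_of_le ht] at hs
    simp only [hU s hs.1]
  · intro h
    refine ⟨fun t ht ξ => ?_, fun t ht ξ => ?_, fun t ht ξ => by rw [h t ht]; rfl,
      fun t ht ξ => by rw [h t ht]; rfl⟩
    · rw [h t ht]
      simp only [evolve]
      congr 1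
      refine intervalIntegral.integral_congr fun s hs => ?_
      rw [uIcc_of_le ht] at hs
      simp only [h s hs.1, evolve]
    · rw [h t ht]
      simp only [evolve, velocityU]
      congr 1
      refine intervalIntegral.integral_congr fun s hs => ?_
      rw [uIcc_of_le ht] at hs
      simp only [h s hs.1, evolve]

/-- The solution operator `T_t = M ∘ S_t ∘ L` in Eulerian coordinates. -/
def solve (α : ℝ) (t : ℝ) (Z : Euler) : Euler := mapM (evolve α t (mapL Z))

/-! ### The projection operator -/

/-- The difference quotient `D f_{2j} = (f(x_{2j+2}) - f(x_{2j})) / (2 Δx)` on the grid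
`x_j = j Δx`. -/
def diffQ (dx : ℝ) (f : ℝ → ℝ) (j : ℤ) : ℝ :=
  (f ((2 * j + 2) * dx) - f (2 * j * dx)) / (2 * dx)

/-- `q_{2j} = √(D F_{ac,2j} - (D u_{2j})²)`. -/
def slopeQ (dx : ℝ) (Z : Euler) (j : ℤ) : ℝ :=
  Real.sqrt (diffQ dx (prim (acPart Z.μ)) j - diffQ dx Z.u j ^ 2)

/-- The index `j` of the double cell with `x_{2j} < x ≤ x_{2j+2}`. -/
def cell (dx x : ℝ) : ℤ := ⌈x / (2 * dx)⌉ - 1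

open Classical in
/-- `u_Δx`. The sign `ε j` is the choice made on the double cell `(x_{2j}, x_{2j+2}]`: the slopes
on its two halves are `D u_{2j} - ε j q_{2j}` and `D u_{2j} + ε j q_{2j}`. -/
def projU (dx : ℝ) (ε : ℤ → ℤˣ) (Z : Euler) (x : ℝ) : ℝ :=
  let j : ℤ := cell dx x
  let e : ℝ := ((ε j : ℤ) : ℝ)
  if x ≤ (2 * j + 1) * dx then
    Z.u (2 * j * dx) + (diffQ dx Z.u j - e * slopeQ dx Z j) * (x - 2 * j * dx)
  else
    Z.u ((2 * j + 2) * dx) +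
      (diffQ dx Z.u j + e * slopeQ dx Z j) * (x - (2 * j + 2) * dx)

open Classical in
/-- `F_{Δx,ac}`. -/
def projFac (dx : ℝ) (ε : ℤ → ℤˣ) (Z : Euler) (x : ℝ) : ℝ :=
  let j : ℤ := cell dx x
  let e : ℝ := ((ε j : ℤ) : ℝ)
  let Fac : ℝ → ℝ := prim (acPart Z.μ)
  if x ≤ (2 * j + 1) * dx then
    Fac (2 * j * dx) + (diffQ dx Z.u j - e * slopeQ dx Z j) ^ 2 * (x - 2 * j * dx)
  else
    (Fac ((2 * j + 2) * dx) + Fac (2 * j * dx)) / 2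
      - e * (2 * slopeQ dx Z j * diffQ dx Z.u j * dx)
      + (diffQ dx Z.u j + e * slopeQ dx Z j) ^ 2 * (x - (2 * j + 1) * dx)

/-- `F_{Δx,sing}`. -/
def projFsing (dx : ℝ) (Z : Euler) (x : ℝ) : ℝ :=
  prim (singPart Z.μ) ((2 * (cell dx x : ℝ) + 2) * dx)

open Classical in
/-- The unique finite measure `m` on `ℝ` with `m((-∞, x)) = F(x)` for all `x`
(and `0` if there is none). -/
def measureOf (F : ℝ → ℝ) : Measure ℝ :=
  if h : ∃ m : Measure ℝ, IsFiniteMeasure m ∧ ∀ x, m (Iio x) = ENNReal.ofReal (F x) then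
    h.choose
  else 0

/-- The projection operator `P_Δx` on `𝒟₀`, with the sign choices `ε`. -/
def proj (dx : ℝ) (ε : ℤ → ℤˣ) (Z : Euler) : Euler where
  u := projU dx ε Z
  μ := measureOf (fun x => projFac dx ε Z x + projFsing dx Z x)
  ν := measureOf (fun x => projFac dx ε Z x + projFsing dx Z x)

end HunterSaxton

end

namespace HunterSaxton

open scoped Interval

/-! ### Primitives of finite measures -/

/-! Everything rests on two properties of a datum `(u, ν)`, bundled in `Compat`: `(Δu)² ≤ Δx · ΔG`,
and `u_x² = G_x` almost everywhere. The exact datum has them by Cauchy–Schwarz (`MemD.compat`), the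
projected one by its affine pieces (`compat_proj`). In Lagrangian coordinates they become `U_ξ² =
y_ξ H_ξ` with `y_ξ + H_ξ = 1` (`Compat.ae_deriv_sq`). The evolution keeps `U_ξ² = y_ξ V_ξ` and `0 ≤
y_ξ ≤ e^{t/2}`, even through wave breaking, where `y_ξ` and `U_ξ` vanish together and the motion
restarts with energy `(1 - α) V_ξ` (`rate_identities`). Hence `y(t)` is a monotone,
`e^{t/2}`-Lipschitz surjection, and `|ΔU|² ≤ F_∞(0) Δy`.

For the velocity, take `y(ξ) = x = y_Δx(η)` and split `U(ξ) - U_Δx(η)` into `U(η) - U_Δx(η)` and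
`U(ξ) - U(η)`. The second piece is at most `√F_∞(0) |y(ξ) - y(η)|^{1/2}`, and `y(ξ) = y_Δx(η)`.

For the energy, `G(t, x)` is the integral of `H_ξ` over `{y(t) < x}`. Replacing `y` by `y_Δx` in the
domain costs at most `G_∞ ‖y - y_Δx‖_∞` in `L¹`, by Fubini. What remains is `H - H_Δx` at the least
`ξ` with `y_Δx(ξ) = x`; as `y_Δx` is `e^{t/2}`-Lipschitz, its `L¹` norm is at most `e^{t/2} ‖H -
H_Δx‖_1`. In turn `‖H - H_Δx‖_1 ≤ ‖G(0) - G_Δx(0)‖_1 ≤ 4 G_∞ Δx`, because the two primitives are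
monotone and agree at the even grid points. This bound is sharper than the one claimed: it has
coefficient 1 instead of 2 and no term in `y_ξ`. -/

theorem prim_mono (ν : Measure ℝ) [IsFiniteMeasure ν] : Monotone (prim ν) := fun _ _ h =>
  ENNReal.toReal_mono (measure_ne_top _ _) (measure_mono (Iio_subset_Iio h))

theorem prim_nonneg (ν : Measure ℝ) (x : ℝ) : 0 ≤ prim ν x := ENNReal.toReal_nonneg

theorem prim_le_total (ν : Measure ℝ) [IsFiniteMeasure ν] (x : ℝ) : prim ν x ≤ total ν :=
  ENNReal.toReal_mono (measure_ne_top _ _) (measure_mono (subset_univ _))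

theorem total_nonneg (ν : Measure ℝ) : 0 ≤ total ν := ENNReal.toReal_nonneg

theorem prim_sub_prim (ν : Measure ℝ) [IsFiniteMeasure ν] {a b : ℝ} (h : a ≤ b) :
    prim ν b - prim ν a = (ν (Ico a b)).toReal := by
  have : ν (Iio b) = ν (Iio a) + ν (Ico a b) := by
    rw [← Iio_union_Ico_eq_Iio h, measure_union _ measurableSet_Ico]
    exact Set.disjoint_left.2 fun x hx hx' => not_lt.2 hx'.1 hx
  rw [prim, prim, this, ENNReal.toReal_add (measure_ne_top _ _) (measure_ne_top _ _)]
  ring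

theorem tendsto_prim_atBot (ν : Measure ℝ) [IsFiniteMeasure ν] :
    Tendsto (prim ν) atBot (𝓝 0) := by
  have h : Tendsto (fun x : ℝ => ν (Iio x)) atBot (𝓝 (ν (⋂ x : ℝ, Iio x))) :=
    tendsto_measure_iInter_atBot (fun _ => measurableSet_Iio.nullMeasurableSet)
      (fun _ _ h => Iio_subset_Iio h) ⟨0, measure_ne_top _ _⟩
  have e : (⋂ x : ℝ, Iio x) = ∅ := by
    ext z
    simp only [mem_iInter, mem_Iio, mem_empty_iff_false, iff_false, not_forall, not_lt]
    exact ⟨z, le_rfl⟩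
  rw [e, measure_empty] at h
  exact (ENNReal.tendsto_toReal ENNReal.zero_ne_top).comp h

theorem tendsto_prim_nhdsLT (ν : Measure ℝ) [IsFiniteMeasure ν] (x : ℝ) :
    Tendsto (prim ν) (𝓝[<] x) (𝓝 (prim ν x)) := by
  have hs := (prim_mono ν).tendsto_nhdsLT x
  have h1 : Tendsto (fun n : ℕ => x - 1 / ((n : ℝ) + 1)) atTop (𝓝[<] x) := by
    refine tendsto_nhdsWithin_iff.2 ⟨?_, Eventually.of_forall fun n => ?_⟩
    · simpa using tendsto_const_nhds.sub (tendsto_one_div_add_atTop_nhds_zero_nat (𝕜 := ℝ))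
    · have : (0 : ℝ) < 1 / ((n : ℝ) + 1) := by positivity
      simpa using this
  have h2 : Tendsto (fun n : ℕ => ν (Iio (x - 1 / ((n : ℝ) + 1)))) atTop
      (𝓝 (ν (⋃ n : ℕ, Iio (x - 1 / ((n : ℝ) + 1))))) := by
    refine tendsto_measure_iUnion_atTop fun m n hmn => Iio_subset_Iio ?_
    have : 1 / ((n : ℝ) + 1) ≤ 1 / ((m : ℝ) + 1) := by
      gcongr
    linarith
  have e : (⋃ n : ℕ, Iio (x - 1 / ((n : ℝ) + 1))) = Iio x := by
    ext z
    simp only [mem_iUnion, mem_Iio]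
    constructor
    · rintro ⟨n, hn⟩
      have : (0 : ℝ) < 1 / ((n : ℝ) + 1) := by positivity
      linarith
    · intro hz
      obtain ⟨n, hn⟩ := exists_nat_one_div_lt (sub_pos.2 hz)
      exact ⟨n, by linarith⟩
  -- The left limit exists by monotonicity, so one sequence, along which continuity of `ν` from
  -- below applies, identifies it.
  rw [e] at h2
  have h3 := (ENNReal.tendsto_toReal (measure_ne_top ν (Iio x))).comp h2
  have h4 := hs.comp h1
  have := tendsto_nhds_unique h3 h4
  rw [← show (ν (Iio x)).toReal = sSup (prim ν '' Iio x) from this] at hs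
  exact hs

/-! ### The characteristic -/

/-- Left-continuity of `x ↦ G(x) + x` turns the supremum into a Galois connection. All later facts
on the characteristic come from it, including at atoms of `ν`, where `y` is constant. -/
theorem le_charL_iff (ν : Measure ℝ) [IsFiniteMeasure ν] (x ξ : ℝ) :
    x ≤ charL ν ξ ↔ prim ν x + x ≤ ξ := by
  have hb : BddAbove {x : ℝ | prim ν x + x < ξ} :=
    ⟨ξ, fun z hz => by
      rw [mem_ofPred_eq] at hz
      linarith [prim_nonneg ν z]⟩
  have hn : {x : ℝ | prim ν x + x < ξ}.Nonempty :=
    ⟨ξ - total ν - 1, by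
      have := prim_le_total ν (ξ - total ν - 1)
      simp only [mem_ofPred_eq]; linarith⟩
  constructor
  · intro h
    have key : ∀ z < x, prim ν z + z ≤ ξ := by
      intro z hz
      obtain ⟨w, hw, hzw⟩ := exists_lt_of_lt_csSup hn (hz.trans_le h)
      have := prim_mono ν hzw.le
      simp only [mem_ofPred_eq] at hw
      linarith
    have ht : Tendsto (fun z => prim ν z + z) (𝓝[<] x) (𝓝 (prim ν x + x)) :=
      (tendsto_prim_nhdsLT ν x).add (tendsto_id.mono_left nhdsWithin_le_nhds)
    exact le_of_tendsto ht (eventually_nhdsWithin_of_forall key)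
  · intro h
    refine le_of_forall_lt fun z hz => ?_
    refine lt_of_lt_of_le (b := (z + x) / 2) (by linarith) (le_csSup hb ?_)
    have := prim_mono ν (show (z + x) / 2 ≤ x by linarith)
    simp only [mem_ofPred_eq]; linarith

theorem charL_lt_iff (ν : Measure ℝ) [IsFiniteMeasure ν] (x ξ : ℝ) :
    charL ν ξ < x ↔ ξ < prim ν x + x := by
  simpa using (le_charL_iff ν x ξ).not

theorem prim_charL_le (ν : Measure ℝ) [IsFiniteMeasure ν] (ξ : ℝ) :
    prim ν (charL ν ξ) + charL ν ξ ≤ ξ := (le_charL_iff ν _ ξ).1 le_rfl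

theorem charL_prim_add (ν : Measure ℝ) [IsFiniteMeasure ν] (x : ℝ) :
    charL ν (prim ν x + x) = x := by
  refine le_antisymm ?_ ((le_charL_iff ν _ _).2 le_rfl)
  by_contra! h
  have h1 := prim_charL_le ν (prim ν x + x)
  have := prim_mono ν h.le
  linarith

theorem charL_mono (ν : Measure ℝ) [IsFiniteMeasure ν] : Monotone (charL ν) := fun a _ h =>
  (le_charL_iff ν _ _).2 ((prim_charL_le ν a).trans h)

theorem charL_sub_le (ν : Measure ℝ) [IsFiniteMeasure ν] {a b : ℝ} (h : a ≤ b) :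
    charL ν b - charL ν a ≤ b - a := by
  have : charL ν b - (b - a) ≤ charL ν a := by
    rw [le_charL_iff]
    have h1 := prim_charL_le ν b
    have := prim_mono ν (show charL ν b - (b - a) ≤ charL ν b by linarith)
    linarith
  linarith

theorem charL_le (ν : Measure ℝ) [IsFiniteMeasure ν] (ξ : ℝ) : charL ν ξ ≤ ξ := by
  linarith [prim_charL_le ν ξ, prim_nonneg ν (charL ν ξ)]

theorem sub_charL_le (ν : Measure ℝ) [IsFiniteMeasure ν] (ξ : ℝ) : ξ - charL ν ξ ≤ total ν := by
  have : ξ - total ν ≤ charL ν ξ := by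
    rw [le_charL_iff]
    linarith [prim_le_total ν (ξ - total ν)]
  linarith

theorem lipschitzWith_of_sub_le {f : ℝ → ℝ} {K : NNReal} (hf : Monotone f)
    (h : ∀ a b, a ≤ b → f b - f a ≤ K * (b - a)) : LipschitzWith K f := by
  refine LipschitzWith.of_dist_le_mul fun a b => ?_
  rw [Real.dist_eq, Real.dist_eq]
  rcases le_total a b with hab | hab
  · rw [abs_sub_comm, abs_of_nonneg (sub_nonneg.2 (hf hab)), abs_sub_comm,
      abs_of_nonneg (sub_nonneg.2 hab)]
    exact h a b hab
  · rw [abs_of_nonneg (sub_nonneg.2 (hf hab)), abs_of_nonneg (sub_nonneg.2 hab)]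
    exact h b a hab

theorem charL_lipschitz (ν : Measure ℝ) [IsFiniteMeasure ν] : LipschitzWith 1 (charL ν) :=
  lipschitzWith_of_sub_le (charL_mono ν) fun _ _ h => by simpa using charL_sub_le ν h

/-- The initial Lagrangian energy `H(ξ) = ξ - y(ξ)`. -/
noncomputable def energyH (ν : Measure ℝ) (ξ : ℝ) : ℝ := ξ - charL ν ξ

theorem energyH_mono (ν : Measure ℝ) [IsFiniteMeasure ν] : Monotone (energyH ν) := fun a b h => by
  have := charL_sub_le ν h
  simp only [energyH]; linarith

theorem energyH_lipschitz (ν : Measure ℝ) [IsFiniteMeasure ν] : LipschitzWith 1 (energyH ν) :=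
  lipschitzWith_of_sub_le (energyH_mono ν) fun _ _ h => by
    have := charL_mono ν h
    simp only [energyH, NNReal.coe_one]; linarith

theorem energyH_nonneg (ν : Measure ℝ) [IsFiniteMeasure ν] (ξ : ℝ) : 0 ≤ energyH ν ξ :=
  sub_nonneg.2 (charL_le ν ξ)

theorem energyH_le (ν : Measure ℝ) [IsFiniteMeasure ν] (ξ : ℝ) : energyH ν ξ ≤ total ν :=
  sub_charL_le ν ξ

theorem energyH_prim_add (ν : Measure ℝ) [IsFiniteMeasure ν] (x : ℝ) :
    energyH ν (prim ν x + x) = prim ν x := by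
  rw [energyH, charL_prim_add]; ring

theorem tendsto_energyH_atBot (ν : Measure ℝ) [IsFiniteMeasure ν] :
    Tendsto (energyH ν) atBot (𝓝 0) := by
  refine tendsto_order.2 ⟨fun a ha => Eventually.of_forall fun ξ => ha.trans_le
    (energyH_nonneg ν ξ), fun a ha => ?_⟩
  obtain ⟨x, hx⟩ := ((tendsto_order.1 (tendsto_prim_atBot ν)).2 a ha).exists
  filter_upwards [eventually_le_atBot (prim ν x + x)] with ξ hξ
  exact (energyH_mono ν hξ).trans_lt (by rwa [energyH_prim_add])

/-! ### The energy density in the label variable and its pushforward -/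

theorem integral_deriv_of_lipschitz {f : ℝ → ℝ} {K : NNReal} (hf : LipschitzWith K f) (a b : ℝ) :
    ∫ x in a..b, deriv f x = f b - f a :=
  (hf.lipschitzOnWith.absolutelyContinuousOnInterval).integral_deriv_eq_sub

theorem intervalIntegrable_deriv_of_lipschitz {f : ℝ → ℝ} {K : NNReal} (hf : LipschitzWith K f)
    (a b : ℝ) : IntervalIntegrable (deriv f) volume a b :=
  (hf.lipschitzOnWith.absolutelyContinuousOnInterval).intervalIntegrable_deriv

theorem abs_deriv_le_of_lipschitz {f : ℝ → ℝ} {K : NNReal} (hf : LipschitzWith K f) (x : ℝ) :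
    |deriv f x| ≤ K := by
  simpa using norm_deriv_le_of_lipschitz hf (x₀ := x)

/-- `H` is monotone and takes values in `[0, total ν]`, so the integrals of its nonnegative
derivative over bounded intervals stay below `total ν`. -/
theorem integrable_deriv_energyH (ν : Measure ℝ) [IsFiniteMeasure ν] :
    Integrable (deriv (energyH ν)) := by
  refine integrable_of_intervalIntegral_norm_bounded (total ν) (a := fun n : ℕ => -(n : ℝ))
    (b := fun n : ℕ => (n : ℝ)) (l := atTop) (fun n => ?_)
    (tendsto_neg_atTop_atBot.comp tendsto_natCast_atTop_atTop) tendsto_natCast_atTop_atTop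
    (Eventually.of_forall fun n => ?_)
  · have := (intervalIntegrable_deriv_of_lipschitz (energyH_lipschitz ν) (-(n : ℝ)) n)
    exact this.1
  · have e : ∀ x, ‖deriv (energyH ν) x‖ = deriv (energyH ν) x := fun x =>
      Real.norm_of_nonneg (energyH_mono ν).deriv_nonneg
    simp only [e]
    rw [integral_deriv_of_lipschitz (energyH_lipschitz ν)]
    linarith [energyH_le ν n, energyH_nonneg ν (-n)]

theorem integral_Iic_deriv_energyH (ν : Measure ℝ) [IsFiniteMeasure ν] (ξ : ℝ) :
    ∫ η in Iic ξ, deriv (energyH ν) η = energyH ν ξ := by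
  have h1 := intervalIntegral_tendsto_integral_Iic ξ (integrable_deriv_energyH ν).integrableOn
    tendsto_id
  simp only [integral_deriv_of_lipschitz (energyH_lipschitz ν), id] at h1
  have h2 : Tendsto (fun i => energyH ν ξ - energyH ν i) atBot (𝓝 (energyH ν ξ - 0)) :=
    tendsto_const_nhds.sub (tendsto_energyH_atBot ν)
  rw [sub_zero] at h2
  exact tendsto_nhds_unique h1 h2

theorem integral_deriv_energyH_le (ν : Measure ℝ) [IsFiniteMeasure ν] :
    ∫ η, deriv (energyH ν) η ≤ total ν := by
  have h1 := intervalIntegral_tendsto_integral (integrable_deriv_energyH ν)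
    tendsto_neg_atTop_atBot tendsto_id
  refine le_of_tendsto h1 (Eventually.of_forall fun n => ?_)
  rw [integral_deriv_of_lipschitz (energyH_lipschitz ν)]
  linarith [energyH_le ν (id n), energyH_nonneg ν (-n)]

theorem deriv_energyH_nonneg (ν : Measure ℝ) [IsFiniteMeasure ν] (x : ℝ) :
    0 ≤ deriv (energyH ν) x := (energyH_mono ν).deriv_nonneg

theorem deriv_energyH_le_one (ν : Measure ℝ) [IsFiniteMeasure ν] (x : ℝ) :
    deriv (energyH ν) x ≤ 1 := by
  simpa using (le_abs_self _).trans (abs_deriv_le_of_lipschitz (energyH_lipschitz ν) x)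

/-- The pushforward of `H_ξ dξ` under the characteristic is `ν`. -/
theorem map_charL_withDensity (ν : Measure ℝ) [IsFiniteMeasure ν] :
    (volume.withDensity (fun ξ => ENNReal.ofReal (deriv (energyH ν) ξ))).map (charL ν) = ν := by
  have hm : Measurable (charL ν) := (charL_lipschitz ν).continuous.measurable
  have hI : ∀ x, (volume.withDensity (fun ξ => ENNReal.ofReal (deriv (energyH ν) ξ))).map (charL ν)
      (Iio x) = ν (Iio x) := by
    intro x
    have e : charL ν ⁻¹' Iio x = Iio (prim ν x + x) := by
      ext ξ; exact charL_lt_iff ν x ξ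
    rw [Measure.map_apply hm measurableSet_Iio, e, withDensity_apply _ measurableSet_Iio,
      ← ofReal_integral_eq_lintegral_ofReal (integrable_deriv_energyH ν).integrableOn
        (Eventually.of_forall (deriv_energyH_nonneg ν)), ← integral_Iic_eq_integral_Iio,
      integral_Iic_deriv_energyH, energyH_prim_add, prim, ENNReal.ofReal_toReal
        (measure_ne_top _ _)]
  have : IsFiniteMeasure
      ((volume.withDensity (fun ξ => ENNReal.ofReal (deriv (energyH ν) ξ))).map (charL ν)) := by
    have := isFiniteMeasure_withDensity_ofReal (integrable_deriv_energyH ν).2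
    infer_instance
  have hIco : ∀ a b : ℝ, a < b →
      (volume.withDensity (fun ξ => ENNReal.ofReal (deriv (energyH ν) ξ))).map (charL ν)
        (Ico a b) = ν (Ico a b) := by
    intro a b hab
    rw [← ENNReal.toReal_eq_toReal_iff' (measure_ne_top _ _) (measure_ne_top _ _),
      ← prim_sub_prim _ hab.le, ← prim_sub_prim _ hab.le]
    simp only [prim, hI]
  exact Measure.ext_of_Ico _ _ fun a b hab => hIco a b hab

/-- With `μ = ν` the density `dμ/dν` is 1 off a `ν`-null set. Since `ν` is the pushforward of `H_ξ
dξ`, it is 1 at `y(ξ)` for almost every `ξ` with `H_ξ ≠ 0`; elsewhere the integrand vanishes anyway.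
-/
theorem mapL_V (Z : Euler) (h : Z.μ = Z.ν) [IsFiniteMeasure Z.ν] :
    (mapL Z).V = energyH Z.ν := by
  funext ξ
  rw [← integral_Iic_deriv_energyH]
  refine integral_congr_ae (ae_restrict_of_ae ?_)
  have h1 : ∀ᵐ x ∂Z.ν, Z.ν.rnDeriv Z.ν x = 1 := Measure.rnDeriv_self Z.ν
  rw [← map_charL_withDensity Z.ν] at h1
  have h2 := ae_of_ae_map (charL_lipschitz Z.ν).continuous.measurable.aemeasurable h1
  rw [map_charL_withDensity Z.ν, ae_withDensity_iff (by fun_prop)] at h2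
  filter_upwards [h2] with η hη
  rw [h]
  by_cases h0 : deriv (energyH Z.ν) η = 0
  · change _ * deriv (energyH Z.ν) η = _
    rw [h0, mul_zero]
  · rw [hη, ENNReal.toReal_one, one_mul]
    · rfl
    · have := (deriv_energyH_nonneg Z.ν η).lt_of_ne' h0
      simpa using this

/-- The compatibility of the velocity `u` with the energy measure `ν` that is needed to pass to
Lagrangian coordinates: the energy controls the increments of `u`, and the density of the
absolutely continuous part of `ν` is `u_x²`. -/
structure Compat (u : ℝ → ℝ) (ν : Measure ℝ) : Prop where
  finite : IsFiniteMeasure ν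
  sq_le : ∀ a b, a ≤ b → (u b - u a) ^ 2 ≤ (b - a) * (prim ν b - prim ν a)
  ae_deriv : ∀ᵐ x, ∃ d, HasDerivAt u d x ∧ HasDerivAt (prim ν) (d ^ 2) x

/-! ### Half-Hölder velocities and the initial relation between the Lagrangian derivatives -/

theorem abs_sub_le_sqrt_of_sq_le {u : ℝ → ℝ} {C : ℝ}
    (h : ∀ a b, a ≤ b → (u b - u a) ^ 2 ≤ (b - a) * C) (a b : ℝ) :
    |u b - u a| ≤ √C * √|b - a| := by
  have key : ∀ a b, a ≤ b → |u b - u a| ≤ √C * √|b - a| := by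
    intro a b hab
    rcases hab.eq_or_lt with rfl | hlt
    · simp
    · have h1 := h a b hab
      have hC : 0 ≤ C := by
        by_contra! hC
        nlinarith [sq_nonneg (u b - u a), mul_neg_of_pos_of_neg (sub_pos.2 hlt) hC]
      rw [← Real.sqrt_mul hC, abs_of_pos (sub_pos.2 hlt)]
      exact Real.abs_le_sqrt (by linarith)
  rcases le_total a b with hab | hab
  · exact key a b hab
  · rw [abs_sub_comm, abs_sub_comm b a]
    exact key b a hab

theorem continuous_of_sq_le {u : ℝ → ℝ} {C : ℝ}
    (h : ∀ a b, a ≤ b → (u b - u a) ^ 2 ≤ (b - a) * C) : Continuous u := by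
  rw [continuous_iff_continuousAt]
  intro a
  rw [ContinuousAt, tendsto_iff_dist_tendsto_zero]
  have h0 : Tendsto (fun b => √C * √|b - a|) (𝓝 a) (𝓝 0) := by
    have : Continuous fun b => √C * √|b - a| := by fun_prop
    simpa using this.tendsto a
  exact squeeze_zero (fun _ => dist_nonneg) (fun b => abs_sub_le_sqrt_of_sq_le h a b) h0

theorem Compat.sq_le_total {u : ℝ → ℝ} {ν : Measure ℝ} (h : Compat u ν) (a b : ℝ) (hab : a ≤ b) :
    (u b - u a) ^ 2 ≤ (b - a) * total ν := by
  have := h.finite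
  refine (h.sq_le a b hab).trans (mul_le_mul_of_nonneg_left ?_ (sub_nonneg.2 hab))
  linarith [prim_nonneg ν a, prim_le_total ν b]

theorem Compat.continuous {u : ℝ → ℝ} {ν : Measure ℝ} (h : Compat u ν) : Continuous u :=
  continuous_of_sq_le h.sq_le_total

/-- `H(ξ)` need not equal `G(y(ξ))`, as `ξ` may lie in the interval of labels of an atom.
Approaching `y(a)` from the right by `z`, one has `G(z) + z > a`, and the limit `z → y(a)` yields
the exact increment of `H`. -/
theorem Compat.sq_comp_charL_le {u : ℝ → ℝ} {ν : Measure ℝ} (h : Compat u ν) {a b : ℝ}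
    (hab : a ≤ b) : (u (charL ν b) - u (charL ν a)) ^ 2 ≤
      (charL ν b - charL ν a) * (energyH ν b - energyH ν a) := by
  have := h.finite
  rcases (charL_mono ν hab).eq_or_lt with he | hlt
  · rw [he]; simp
  · have hev : ∀ᶠ z in 𝓝[>] (charL ν a), (u (charL ν b) - u z) ^ 2 ≤
        (charL ν b - z) * ((b - charL ν b) - (a - z)) := by
      filter_upwards [Ioo_mem_nhdsGT hlt] with z hz
      refine (h.sq_le z _ hz.2.le).trans (mul_le_mul_of_nonneg_left ?_ (sub_nonneg.2 hz.2.le))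
      have h1 := (charL_lt_iff ν z a).1 hz.1
      have h2 := prim_charL_le ν b
      linarith
    have hc := h.continuous
    have t1 : Tendsto (fun z => (u (charL ν b) - u z) ^ 2) (𝓝[>] (charL ν a))
        (𝓝 ((u (charL ν b) - u (charL ν a)) ^ 2)) :=
      ((by fun_prop : Continuous fun z => (u (charL ν b) - u z) ^ 2).tendsto _).mono_left
        nhdsWithin_le_nhds
    have t2 : Tendsto (fun z => (charL ν b - z) * ((b - charL ν b) - (a - z))) (𝓝[>] (charL ν a))
        (𝓝 ((charL ν b - charL ν a) * ((b - charL ν b) - (a - charL ν a)))) :=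
      ((by fun_prop : Continuous fun z => (charL ν b - z) * ((b - charL ν b) - (a - z))).tendsto
        _).mono_left nhdsWithin_le_nhds
    exact le_of_tendsto_of_tendsto t1 t2 hev

theorem Compat.comp_charL_lipschitz {u : ℝ → ℝ} {ν : Measure ℝ} (h : Compat u ν) :
    LipschitzWith 1 (fun ξ => u (charL ν ξ)) := by
  have := h.finite
  refine LipschitzWith.of_dist_le_mul fun a b => ?_
  have key : ∀ a b, a ≤ b → |u (charL ν b) - u (charL ν a)| ≤ b - a := by
    intro a b hab
    refine abs_le_of_sq_le_sq ?_ (sub_nonneg.2 hab)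
    have h1 := h.sq_comp_charL_le hab
    have h2 := charL_sub_le ν hab
    have h3 := charL_mono ν hab
    have h4 := energyH_mono ν hab
    have h5 : energyH ν b - energyH ν a ≤ b - a := by simp only [energyH]; linarith
    nlinarith
  rw [Real.dist_eq, Real.dist_eq, NNReal.coe_one, one_mul]
  rcases le_total a b with hab | hab
  · rw [abs_sub_comm, abs_sub_comm a b, abs_of_nonneg (sub_nonneg.2 hab)]
    exact key a b hab
  · rw [abs_of_nonneg (sub_nonneg.2 hab)]
    exact key b a hab

/-- By the area formula the integral of `f'` over the preimage of a null set is the measure of the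
image, namely zero. A property that holds for almost every `x` thus holds at `f ξ` for almost every
`ξ` with `f' ξ ≠ 0`. -/
theorem ae_deriv_eq_zero_of_null {f : ℝ → ℝ} {K : NNReal} (hf : Monotone f)
    (hL : LipschitzWith K f) {N : Set ℝ} (hN : volume N = 0) :
    ∀ᵐ ξ, f ξ ∈ N → deriv f ξ = 0 := by
  obtain ⟨N', hNN', hmN', hN'⟩ := exists_measurable_superset_of_null hN
  set s : Set ℝ := f ⁻¹' N' ∩ {ξ | DifferentiableAt ℝ f ξ} with hs
  have hms : MeasurableSet s :=
    (hL.continuous.measurable hmN').inter (measurableSet_of_differentiableAt ℝ f)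
  have h1 := lintegral_deriv_eq_volume_image_of_monotoneOn hms (f := f) (f' := deriv f)
    (fun x hx => hx.2.hasDerivAt.hasDerivWithinAt) (hf.monotoneOn _)
  have h2 : volume (f '' s) = 0 :=
    measure_mono_null (by rintro _ ⟨x, hx, rfl⟩; exact hx.1) hN'
  rw [h2, lintegral_eq_zero_iff (by fun_prop), Filter.EventuallyEq, ae_restrict_iff' hms] at h1
  filter_upwards [h1, hL.ae_differentiableAt_real] with ξ h3 h4 h5
  have h6 := h3 ⟨hNN' h5, h4⟩
  simp only [Pi.zero_apply, ENNReal.ofReal_eq_zero] at h6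
  exact le_antisymm h6 hf.deriv_nonneg

theorem ae_deriv_charL_add (ν : Measure ℝ) [IsFiniteMeasure ν] :
    ∀ᵐ ξ, deriv (charL ν) ξ + deriv (energyH ν) ξ = 1 := by
  filter_upwards [(charL_lipschitz ν).ae_differentiableAt_real] with ξ h
  have : HasDerivAt (energyH ν) (1 - deriv (charL ν) ξ) ξ := (hasDerivAt_id ξ).sub h.hasDerivAt
  rw [this.deriv]; ring

/-- Where `u` and `G` are differentiable at `y(ξ)` with derivatives `d` and `d²`, inverting `x ↦
G(x) + x` gives `y_ξ = 1/(1 + d²)`, `U_ξ = d/(1 + d²)`, `H_ξ = d²/(1 + d²)`. At almost all other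
labels `y_ξ = 0`, and `(ΔU)² ≤ Δy ΔH` forces `U_ξ = 0`. -/
theorem Compat.ae_deriv_sq {u : ℝ → ℝ} {ν : Measure ℝ} (h : Compat u ν) :
    ∀ᵐ ξ, deriv (fun ξ => u (charL ν ξ)) ξ ^ 2 = deriv (charL ν) ξ * deriv (energyH ν) ξ := by
  have := h.finite
  filter_upwards [ae_deriv_eq_zero_of_null (charL_mono ν) (charL_lipschitz ν)
    (ae_iff.1 h.ae_deriv), (charL_lipschitz ν).ae_differentiableAt_real,
    h.comp_charL_lipschitz.ae_differentiableAt_real, ae_deriv_charL_add ν] with ξ h1 h2 h3 h4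
  by_cases hg : ∃ d, HasDerivAt u d (charL ν ξ) ∧ HasDerivAt (prim ν) (d ^ 2) (charL ν ξ)
  · obtain ⟨d, hu, hG⟩ := hg
    set x := charL ν ξ with hx
    have hΦ : HasDerivAt (fun z => prim ν z + z) (d ^ 2 + 1) x := hG.add (hasDerivAt_id x)
    -- Differentiability of `G` at `x` rules out an atom there, so `ξ` is the only label of `x`.
    have hξ : prim ν x + x = ξ := by
      refine le_antisymm (prim_charL_le ν ξ) ?_
      have ht : Tendsto (fun z => prim ν z + z) (𝓝[>] x) (𝓝 (prim ν x + x)) :=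
        hΦ.continuousAt.tendsto.mono_left nhdsWithin_le_nhds
      refine ge_of_tendsto ht (eventually_nhdsWithin_of_forall fun z hz => ?_)
      exact ((charL_lt_iff ν z ξ).1 hz).le
    have hy : HasDerivAt (charL ν) (deriv (charL ν) ξ) (prim ν x + x) := by
      rw [hξ]; exact h2.hasDerivAt
    have hU : HasDerivAt (fun ξ => u (charL ν ξ)) (deriv (fun ξ => u (charL ν ξ)) ξ)
        (prim ν x + x) := by
      rw [hξ]; exact h3.hasDerivAt
    have e1 : deriv (charL ν) ξ * (d ^ 2 + 1) = 1 := by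
      have c := HasDerivAt.comp (h := fun z => prim ν z + z) x hy hΦ
      have e : charL ν ∘ (fun z => prim ν z + z) = id := by
        funext z; exact charL_prim_add ν z
      rw [e] at c
      exact c.unique (hasDerivAt_id x)
    have e2 : deriv (fun ξ => u (charL ν ξ)) ξ * (d ^ 2 + 1) = d := by
      have c := HasDerivAt.comp (h := fun z => prim ν z + z) x hU hΦ
      have e : (fun ξ => u (charL ν ξ)) ∘ (fun z => prim ν z + z) = u := by
        funext z; simp [charL_prim_add ν z]
      rw [e] at c
      exact c.unique hu
    have hpos : (0 : ℝ) < d ^ 2 + 1 := by positivity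
    have e3 : deriv (charL ν) ξ = 1 / (d ^ 2 + 1) := by field_simp; linarith
    have e4 : deriv (fun ξ => u (charL ν ξ)) ξ = d / (d ^ 2 + 1) := by field_simp; linarith
    rw [e4, show deriv (energyH ν) ξ = 1 - deriv (charL ν) ξ by linarith, e3]
    field_simp
    ring
  · have h0 := h1 hg
    rw [h0, zero_mul, sq_eq_zero_iff]
    have t1 := (h3.hasDerivAt.tendsto_slope).pow 2
    have t2 := h2.hasDerivAt.tendsto_slope
    rw [h0] at t2
    have hz : Tendsto (fun z => slope (fun ξ => u (charL ν ξ)) ξ z ^ 2) (𝓝[≠] ξ) (𝓝 0) := by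
      refine squeeze_zero' (Eventually.of_forall fun z => sq_nonneg _)
        (eventually_nhdsWithin_of_forall fun z hz => ?_) t2
      have key : ∀ a b, a < b → ((u (charL ν b) - u (charL ν a)) / (b - a)) ^ 2 ≤
          (charL ν b - charL ν a) / (b - a) := by
        intro a b hab
        have hp := sub_pos.2 hab
        have s1 := h.sq_comp_charL_le hab.le
        have s2 : energyH ν b - energyH ν a ≤ b - a := by
          have := charL_mono ν hab.le
          simp only [energyH]; linarith
        have s3 := charL_mono ν hab.le
        rw [div_pow, div_le_div_iff₀ (by positivity) hp]
        nlinarith [mul_le_mul_of_nonneg_left s2 (sub_nonneg.2 s3)]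
      rw [slope_def_field, slope_def_field]
      rcases lt_or_gt_of_ne hz with hlt | hgt
      · have := key z ξ hlt
        rwa [← neg_sub (u (charL ν z)), ← neg_sub z, neg_div_neg_eq,
          ← neg_sub (charL ν z), neg_div_neg_eq] at this
      · exact key ξ z hgt
    simpa using tendsto_nhds_unique t1 hz

/-- Cauchy–Schwarz without square roots: the quadratic `∫ (p c² + 2 r c + v)` is nonnegative for
every `c`, so its discriminant is not positive. -/
theorem sq_integral_le_mul {p r v : ℝ → ℝ} {a b : ℝ} (hab : a ≤ b)
    (hp : IntervalIntegrable p volume a b) (hr : IntervalIntegrable r volume a b)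
    (hv : IntervalIntegrable v volume a b)
    (h : ∀ᵐ x, 0 ≤ p x ∧ 0 ≤ v x ∧ r x ^ 2 ≤ p x * v x) :
    (∫ x in a..b, r x) ^ 2 ≤ (∫ x in a..b, p x) * ∫ x in a..b, v x := by
  have key : ∀ c : ℝ, 0 ≤ (∫ x in a..b, p x) * (c * c) + (2 * ∫ x in a..b, r x) * c +
      ∫ x in a..b, v x := by
    intro c
    have e : (∫ x in a..b, p x) * (c * c) + (2 * ∫ x in a..b, r x) * c + ∫ x in a..b, v x =
        ∫ x in a..b, (p x * (c * c) + r x * (2 * c) + v x) := by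
      rw [intervalIntegral.integral_add ((hp.mul_const _).add (hr.mul_const _)) hv,
        intervalIntegral.integral_add (hp.mul_const _) (hr.mul_const _),
        intervalIntegral.integral_mul_const, intervalIntegral.integral_mul_const]
      ring
    rw [e]
    refine intervalIntegral.integral_nonneg_of_ae hab ?_
    filter_upwards [h] with x hx
    obtain ⟨h1, h2, h3⟩ := hx
    simp only [Pi.zero_apply]
    rcases h1.eq_or_lt with h0 | h0
    · rw [← h0] at h3 ⊢
      have : r x = 0 := by nlinarith [sq_nonneg (r x)]
      rw [this]; linarith
    · have : 0 ≤ p x * (p x * (c * c) + r x * (2 * c) + v x) := by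
        nlinarith [sq_nonneg (p x * c + r x)]
      exact nonneg_of_mul_nonneg_right this h0
  have := discrim_le_zero key
  rw [discrim] at this
  linarith

/-! ### Integrals in time -/

theorem integral_ite_le {c t : ℝ} (hc : 0 < c) (ht : 0 ≤ t) :
    ∫ s in (0 : ℝ)..t, (if c ≤ s then (1 : ℝ) else 0) = max (t - c) 0 := by
  have e : (fun s : ℝ => if c ≤ s then (1 : ℝ) else 0) = (Ici c).indicator 1 := by
    funext s; simp [indicator_apply]
  have e2 : Ioc 0 t ∩ Ici c = Icc c t := by
    ext s
    simp only [mem_inter_iff, mem_Ioc, mem_Ici, mem_Icc]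
    exact ⟨fun h => ⟨h.2, h.1.2⟩, fun h => ⟨⟨hc.trans_le h.1, h.2⟩, h.1⟩⟩
  rw [e, intervalIntegral.integral_of_le ht, setIntegral_indicator measurableSet_Ici, e2]
  simp [Measure.real, ENNReal.toReal_ofReal']

theorem integral_max_sub {c t : ℝ} (hc : 0 < c) (ht : 0 ≤ t) :
    ∫ s in (0 : ℝ)..t, max (s - c) 0 = max (t - c) 0 ^ 2 / 2 := by
  have hz : ∀ r, 0 ≤ r → r ≤ c → ∫ s in (0 : ℝ)..r, max (s - c) 0 = 0 := by
    intro r h0 hr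
    rw [intervalIntegral.integral_congr (g := fun _ => 0), intervalIntegral.integral_zero]
    intro s hs
    rw [uIcc_of_le h0] at hs
    exact max_eq_right (by linarith [hs.2])
  rcases le_total t c with h | h
  · rw [hz t ht h, max_eq_right (by linarith)]; simp
  · have hi : ∀ a b, IntervalIntegrable (fun s => max (s - c) 0) volume a b := fun a b =>
      (by fun_prop : Continuous fun s => max (s - c) 0).intervalIntegrable a b
    rw [← intervalIntegral.integral_add_adjacent_intervals (hi 0 c) (hi c t), hz c hc.le le_rfl,
      intervalIntegral.integral_congr (g := fun s => s - c)]
    · rw [max_eq_left (by linarith), intervalIntegral.integral_sub (by simp) (by simp),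
        integral_id, intervalIntegral.integral_const, smul_eq_mul]
      ring
    · intro s hs
      rw [uIcc_of_le h] at hs
      exact max_eq_left (by linarith [hs.1])

theorem integral_interval_swap {f : ℝ → ℝ → ℝ} (hf : Measurable (Function.uncurry f)) {t a b C : ℝ}
    (ht : 0 ≤ t) (hab : a ≤ b) (hC : ∀ s ∈ Ioc 0 t, ∀ η, |f s η| ≤ C) :
    ∫ s in (0 : ℝ)..t, ∫ η in a..b, f s η = ∫ η in a..b, ∫ s in (0 : ℝ)..t, f s η := by
  simp only [intervalIntegral.integral_of_le ht, intervalIntegral.integral_of_le hab]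
  refine integral_integral_swap (Integrable.of_bound hf.aestronglyMeasurable C ?_)
  rw [Measure.prod_restrict]
  filter_upwards [ae_restrict_mem (measurableSet_Ioc.prod measurableSet_Ioc)] with z hz
  exact hC z.1 hz.1 z.2

/-! ### The rates of change along the label variable -/

/-- The time elapsed since wave breaking. -/
noncomputable def elapsed (X : Lagr) (s η : ℝ) : ℝ :=
  if 0 < waveBreak X η ∧ waveBreak X η < ⊤ then max (s - (waveBreak X η).toReal) 0 else 0

open Classical in
/-- The fraction of the energy which is left at time `s`. -/
noncomputable def remaining (α : ℝ) (X : Lagr) (s η : ℝ) : ℝ :=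
  1 - α * (if waveBreak X η ≤ ENNReal.ofReal s ∧ 0 < waveBreak X η then 1 else 0)

/-- The derivative of `V(s, ·)`. -/
noncomputable def rateV (α : ℝ) (X : Lagr) (s η : ℝ) : ℝ := deriv X.V η * remaining α X s η

/-- The derivative of `U(s, ·)`. -/
noncomputable def rateU (α : ℝ) (X : Lagr) (s η : ℝ) : ℝ :=
  deriv X.U η + 1 / 2 * (deriv X.V η * (s - α * elapsed X s η))

/-- The derivative of `y(s, ·)`. -/
noncomputable def rateY (α : ℝ) (X : Lagr) (s η : ℝ) : ℝ :=
  deriv X.y η + s * deriv X.U η + 1 / 4 * (deriv X.V η * (s ^ 2 - α * elapsed X s η ^ 2))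

theorem measurable_waveBreak (X : Lagr) : Measurable (waveBreak X) := by
  have hU := measurable_deriv X.U
  have hy := measurable_deriv X.y
  refine Measurable.ite (measurableSet_lt hU measurable_const) (by fun_prop)
    (Measurable.ite ?_ measurable_const measurable_const)
  exact (measurableSet_eq_fun hy measurable_const).inter (measurableSet_eq_fun hU measurable_const)

theorem measurable_elapsed (X : Lagr) : Measurable (Function.uncurry (elapsed X)) := by
  have hτ : Measurable fun z : ℝ × ℝ => waveBreak X z.2 :=
    (measurable_waveBreak X).comp measurable_snd
  refine Measurable.ite ?_ (by fun_prop) measurable_const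
  exact (measurableSet_lt measurable_const hτ).inter (measurableSet_lt hτ measurable_const)

theorem measurable_remaining (α : ℝ) (X : Lagr) :
    Measurable (Function.uncurry (remaining α X)) := by
  have hτ : Measurable fun z : ℝ × ℝ => waveBreak X z.2 :=
    (measurable_waveBreak X).comp measurable_snd
  have hs : Measurable fun z : ℝ × ℝ => ENNReal.ofReal z.1 := by fun_prop
  refine measurable_const.sub (measurable_const.mul (Measurable.ite ?_ measurable_const
    measurable_const))
  exact (measurableSet_le hτ hs).inter (measurableSet_lt measurable_const hτ)

theorem remaining_mem {α : ℝ} (hα : α ∈ Icc (0 : ℝ) 1) (X : Lagr) (s η : ℝ) :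
    remaining α X s η ∈ Icc (0 : ℝ) 1 := by
  obtain ⟨h0, h1⟩ := hα
  rw [remaining]
  split_ifs <;> constructor <;> linarith

theorem remaining_antitone {α : ℝ} (hα : α ∈ Icc (0 : ℝ) 1) (X : Lagr) (η : ℝ) :
    Antitone fun s => remaining α X s η := by
  intro s t hst
  obtain ⟨h0, h1⟩ := hα
  simp only [remaining]
  split_ifs with h2 h3 h3 <;> try linarith
  exact absurd ⟨h3.1.trans (ENNReal.ofReal_le_ofReal hst), h3.2⟩ h2

theorem elapsed_mem (X : Lagr) {s : ℝ} (hs : 0 ≤ s) (η : ℝ) : elapsed X s η ∈ Icc 0 s := by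
  rw [elapsed]
  split_ifs
  · exact ⟨le_max_right _ _, max_le (by linarith [ENNReal.toReal_nonneg (a := waveBreak X η)]) hs⟩
  · exact ⟨le_rfl, hs⟩

theorem sub_elapsed_mem {α : ℝ} (hα : α ∈ Icc (0 : ℝ) 1) (X : Lagr) {s : ℝ} (hs : 0 ≤ s) (η : ℝ) :
    s - α * elapsed X s η ∈ Icc 0 s := by
  obtain ⟨h0, h1⟩ := elapsed_mem X hs η
  obtain ⟨h2, h3⟩ := hα
  constructor <;> nlinarith [mul_nonneg h2 h0]

theorem integral_remaining (α : ℝ) (X : Lagr) {t : ℝ} (ht : 0 ≤ t) (η : ℝ) :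
    ∫ s in (0 : ℝ)..t, remaining α X s η = t - α * elapsed X t η := by
  by_cases h : 0 < waveBreak X η ∧ waveBreak X η < ⊤
  · have hτ : 0 < (waveBreak X η).toReal := ENNReal.toReal_pos h.1.ne' h.2.ne
    have e : ∀ s ∈ uIcc 0 t, remaining α X s η =
        1 - α * (if (waveBreak X η).toReal ≤ s then (1 : ℝ) else 0) := by
      intro s hs
      rw [uIcc_of_le ht] at hs
      simp only [remaining, h.1, and_true, ENNReal.le_ofReal_iff_toReal_le h.2.ne hs.1]
    have hi : IntervalIntegrable (fun s : ℝ => if (waveBreak X η).toReal ≤ s then (1 : ℝ) else 0)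
        volume 0 t := by
      refine Monotone.intervalIntegrable fun s r hsr => ?_
      split_ifs <;> linarith
    rw [intervalIntegral.integral_congr e, intervalIntegral.integral_sub (by simp)
      (hi.const_mul α), intervalIntegral.integral_const_mul, integral_ite_le hτ ht, elapsed,
      if_pos h]
    simp
  · have e : ∀ s ∈ uIcc 0 t, remaining α X s η = 1 := by
      intro s _
      have : ¬ (waveBreak X η ≤ ENNReal.ofReal s ∧ 0 < waveBreak X η) := fun h' =>
        h ⟨h'.2, h'.1.trans_lt ENNReal.ofReal_lt_top⟩
      simp [remaining, this]
    rw [intervalIntegral.integral_congr e, elapsed, if_neg h]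
    simp

theorem integral_sub_elapsed (α : ℝ) (X : Lagr) {t : ℝ} (ht : 0 ≤ t) (η : ℝ) :
    ∫ s in (0 : ℝ)..t, (s - α * elapsed X s η) = 1 / 2 * (t ^ 2 - α * elapsed X t η ^ 2) := by
  by_cases h : 0 < waveBreak X η ∧ waveBreak X η < ⊤
  · have hτ : 0 < (waveBreak X η).toReal := ENNReal.toReal_pos h.1.ne' h.2.ne
    simp only [elapsed, if_pos h]
    rw [intervalIntegral.integral_sub (by simp) ((by fun_prop : Continuous fun s =>
      α * max (s - (waveBreak X η).toReal) 0).intervalIntegrable _ _),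
      intervalIntegral.integral_const_mul, integral_max_sub hτ ht, integral_id]
    ring
  · simp only [elapsed, if_neg h]
    simp
    ring

theorem measurable_rateV (α : ℝ) (X : Lagr) : Measurable (Function.uncurry (rateV α X)) :=
  ((measurable_deriv X.V).comp measurable_snd).mul (measurable_remaining α X)

theorem measurable_rateU (α : ℝ) (X : Lagr) : Measurable (Function.uncurry (rateU α X)) := by
  have h := measurable_elapsed X
  have h1 : Measurable fun z : ℝ × ℝ => deriv X.V z.2 := (measurable_deriv X.V).comp measurable_snd
  have h2 : Measurable fun z : ℝ × ℝ => deriv X.U z.2 := (measurable_deriv X.U).comp measurable_snd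
  exact h2.add (measurable_const.mul (h1.mul (measurable_fst.sub (measurable_const.mul h))))

theorem measurable_rateY (α : ℝ) (X : Lagr) : Measurable (Function.uncurry (rateY α X)) := by
  have h := measurable_elapsed X
  have h1 : Measurable fun z : ℝ × ℝ => deriv X.V z.2 := (measurable_deriv X.V).comp measurable_snd
  have h2 : Measurable fun z : ℝ × ℝ => deriv X.U z.2 := (measurable_deriv X.U).comp measurable_snd
  have h3 : Measurable fun z : ℝ × ℝ => deriv X.y z.2 := (measurable_deriv X.y).comp measurable_snd
  exact (h3.add (measurable_fst.mul h2)).add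
    (measurable_const.mul (h1.mul ((measurable_fst.pow_const 2).sub
      (measurable_const.mul (h.pow_const 2)))))

/-- The cubic Taylor polynomial of `exp` exceeds `1 + x²` by `x ((x - 3/2)² + 15/4) / 6`. At `x = s
/ 2` this is the source of the factor `e^{s/2}`. -/
theorem one_add_sq_le_exp {x : ℝ} (hx : 0 ≤ x) : 1 + x ^ 2 ≤ Real.exp x := by
  have h := Real.sum_le_exp_of_nonneg hx 4
  simp only [Finset.sum_range_succ, Finset.sum_range_zero, Nat.factorial] at h
  norm_num at h
  nlinarith [mul_nonneg hx (sq_nonneg (x - 3 / 2))]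

/-- Before breaking, `y_ξ V_ξ - U_ξ²` does not depend on time, and `y_ξ + V_ξ = 1` initially bounds
`y_ξ` by `1 + s²/4`. At the breaking time `T` both `y_ξ` and `U_ξ` are zero. Afterwards `y_ξ` and
`U_ξ` equal `(1 - α) h (s - T)²/4` and `(1 - α) h (s - T)/2`, where `h` is the initial energy
density, and the identity is visible. -/
theorem rate_identities {α : ℝ} (hα : α ∈ Icc (0 : ℝ) 1) (X : Lagr) {s : ℝ} (hs : 0 ≤ s) {η : ℝ}
    (hy : 0 ≤ deriv X.y η) (hV : 0 ≤ deriv X.V η) (h1 : deriv X.y η + deriv X.V η = 1)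
    (hU : deriv X.U η ^ 2 = deriv X.y η * deriv X.V η) :
    0 ≤ rateY α X s η ∧ rateY α X s η ≤ Real.exp (s / 2) ∧ 0 ≤ rateV α X s η ∧
      rateU α X s η ^ 2 = rateY α X s η * rateV α X s η := by
  have hE := one_add_sq_le_exp (show 0 ≤ s / 2 by linarith)
  have hvn : 0 ≤ rateV α X s η := mul_nonneg hV (remaining_mem hα X s η).1
  obtain ⟨ha0, ha1⟩ := hα
  by_cases hb : waveBreak X η ≤ ENNReal.ofReal s ∧ 0 < waveBreak X η
  -- A breaking time that is positive and finite comes only from the branch `U_ξ < 0`; the other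
  -- branches give `0` and `⊤`.
  · have hlt : deriv X.U η < 0 := by
      by_contra! h
      rw [waveBreak, if_neg (not_lt.2 h)] at hb
      split_ifs at hb <;> simp at hb
    have hτ : waveBreak X η = ENNReal.ofReal (-(2 * deriv X.y η) / deriv X.U η) := by
      rw [waveBreak, if_pos hlt]
    have hT : (waveBreak X η).toReal = -(2 * deriv X.y η) / deriv X.U η := by
      rw [hτ, ENNReal.toReal_ofReal]
      exact div_nonneg_of_nonpos (by linarith) hlt.le
    have hle : (waveBreak X η).toReal ≤ s := ENNReal.toReal_le_of_le_ofReal hs hb.1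
    have hel : elapsed X s η = s - (waveBreak X η).toReal := by
      rw [elapsed, if_pos ⟨hb.2, hb.1.trans_lt ENNReal.ofReal_lt_top⟩, max_eq_left (by linarith)]
    have hrem : remaining α X s η = 1 - α := by simp [remaining, hb]
    have hT0 : 0 ≤ (waveBreak X η).toReal := ENNReal.toReal_nonneg
    simp only [rateY, rateU, rateV, hel, hrem] at hvn ⊢
    set T := (waveBreak X η).toReal
    set p := deriv X.y η
    set h := deriv X.V η
    set r := deriv X.U η
    have hr : r ≠ 0 := hlt.ne
    have e1 : T * r = -(2 * p) := by rw [hT]; field_simp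
    -- The definition of `T` says `T r = -2 p`; multiplying by `h` and using `r² = p h` leaves a
    -- common factor `r ≠ 0`. This is the vanishing of `U_ξ` at time `T`.
    have e2 : h * T = -(2 * r) := by
      have : r * (h * T + 2 * r) = 0 := by linear_combination h * e1 + 2 * hU
      rcases mul_eq_zero.1 this with h' | h'
      · exact absurd h' hr
      · linarith
    have eY : p + s * r + 1 / 4 * (h * (s ^ 2 - α * (s - T) ^ 2)) =
        1 / 4 * ((1 - α) * h * (s - T) ^ 2) := by
      linear_combination (s / 2 - T / 4) * e2 + e1 / 2
    have eU : r + 1 / 2 * (h * (s - α * (s - T))) = 1 / 2 * ((1 - α) * h * (s - T)) := by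
      linear_combination e2 / 2
    rw [eY, eU]
    have hc0 : 0 ≤ (1 - α) * h := by nlinarith
    have hc1 : (1 - α) * h ≤ 1 := by nlinarith
    have hq : (s - T) ^ 2 ≤ s ^ 2 := by nlinarith
    refine ⟨by positivity, ?_, by linarith, by ring⟩
    nlinarith [mul_le_mul hc1 hq (sq_nonneg (s - T)) zero_le_one]
  · have hel : elapsed X s η = 0 := by
      rw [elapsed]
      split_ifs with h
      · refine max_eq_right ?_
        have : ENNReal.ofReal s ≤ waveBreak X η := by
          by_contra! h'
          exact hb ⟨h'.le, h.1⟩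
        have := (ENNReal.ofReal_le_iff_le_toReal h.2.ne).1 this
        linarith
      · rfl
    have hrem : remaining α X s η = 1 := by simp [remaining, hb]
    simp only [rateY, rateU, rateV, hel, hrem] at hvn ⊢
    set p := deriv X.y η
    set h := deriv X.V η
    set r := deriv X.U η
    have hid : (r + 1 / 2 * (h * (s - α * 0))) ^ 2 =
        (p + s * r + 1 / 4 * (h * (s ^ 2 - α * 0 ^ 2))) * (h * 1) := by
      linear_combination hU
    refine ⟨?_, ?_, hvn, hid⟩
    · rcases hV.eq_or_lt with h0 | h0
      · rw [← h0] at hU ⊢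
        have : r = 0 := by simpa using hU
        rw [this]; linarith
      · have := hid ▸ sq_nonneg (r + 1 / 2 * (h * (s - α * 0)))
        rw [mul_one] at this
        exact nonneg_of_mul_nonneg_left this h0
    -- Arithmetic–geometric mean: `(s r)² = 4 · h · (s² p / 4)`.
    · have key : s * r ≤ h + s ^ 2 / 4 * p := by
        have hsq : (s * r) ^ 2 ≤ (h + s ^ 2 / 4 * p) ^ 2 := by
          have : (h + s ^ 2 / 4 * p) ^ 2 - (s * r) ^ 2 = (h - s ^ 2 / 4 * p) ^ 2 := by
            linear_combination -(s ^ 2) * hU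
          nlinarith [sq_nonneg (h - s ^ 2 / 4 * p)]
        exact (le_abs_self _).trans (abs_le_of_sq_le_sq hsq (by positivity))
      have : p + s * r + 1 / 4 * (h * (s ^ 2 - α * 0 ^ 2)) ≤ (p + h) * (1 + (s / 2) ^ 2) := by
        nlinarith
      rw [h1] at this
      linarith

/-- The initial datum in Lagrangian coordinates. -/
noncomputable def initialLagr (u : ℝ → ℝ) (ν : Measure ℝ) : Lagr where
  y := charL ν
  U := fun ξ => u (charL ν ξ)
  V := energyH ν
  H := energyH ν

theorem mapL_eq_initialLagr (Z : Euler) (h : Z.μ = Z.ν) [IsFiniteMeasure Z.ν] :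
    mapL Z = initialLagr Z.u Z.ν :=
  Lagr.ext rfl rfl (mapL_V Z h) rfl

/-! ### Regularity of the Lagrangian solution in time and label -/

section Evolution

variable {α : ℝ} {u : ℝ → ℝ} {ν : Measure ℝ}

theorem integrable_rateV (hα : α ∈ Icc (0 : ℝ) 1) [IsFiniteMeasure ν] (s : ℝ) :
    Integrable (rateV α (initialLagr u ν) s) := by
  refine (integrable_deriv_energyH ν).mono'
    ((measurable_rateV α _).comp measurable_prodMk_left).aestronglyMeasurable
    (Eventually.of_forall fun η => ?_)
  obtain ⟨h0, h1⟩ := remaining_mem hα (initialLagr u ν) s η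
  have h2 := deriv_energyH_nonneg ν η
  exact (Real.norm_of_nonneg (mul_nonneg h2 h0)).trans_le (mul_le_of_le_one_right h2 h1)

theorem rateV_nonneg (hα : α ∈ Icc (0 : ℝ) 1) [IsFiniteMeasure ν] (s η : ℝ) :
    0 ≤ rateV α (initialLagr u ν) s η :=
  mul_nonneg (deriv_energyH_nonneg ν η) (remaining_mem hα (initialLagr u ν) s η).1

theorem rateV_le (hα : α ∈ Icc (0 : ℝ) 1) [IsFiniteMeasure ν] (s η : ℝ) :
    rateV α (initialLagr u ν) s η ≤ deriv (energyH ν) η :=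
  mul_le_of_le_one_right (deriv_energyH_nonneg ν η) (remaining_mem hα (initialLagr u ν) s η).2

theorem rateV_antitone (hα : α ∈ Icc (0 : ℝ) 1) [IsFiniteMeasure ν] (η : ℝ) :
    Antitone fun s => rateV α (initialLagr u ν) s η := fun _ _ h =>
  mul_le_mul_of_nonneg_left (remaining_antitone hα _ η h) (deriv_energyH_nonneg ν η)

theorem energyV_eq (s ξ : ℝ) :
    energyV α (initialLagr u ν) s ξ = ∫ η in Iic ξ, rateV α (initialLagr u ν) s η := rfl

theorem energyV_sub (hα : α ∈ Icc (0 : ℝ) 1) [IsFiniteMeasure ν] (s a b : ℝ) :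
    energyV α (initialLagr u ν) s b - energyV α (initialLagr u ν) s a =
      ∫ η in a..b, rateV α (initialLagr u ν) s η := by
  rw [energyV_eq, energyV_eq, intervalIntegral.integral_Iic_sub_Iic
    (integrable_rateV hα s).integrableOn (integrable_rateV hα s).integrableOn]

theorem limUnder_energyV (hα : α ∈ Icc (0 : ℝ) 1) [IsFiniteMeasure ν] (s : ℝ) :
    limUnder atTop (energyV α (initialLagr u ν) s) =
      ∫ η, rateV α (initialLagr u ν) s η := by
  refine Tendsto.limUnder_eq ?_
  have := (aecover_Iic (μ := volume) (tendsto_id (x := (atTop : Filter ℝ)))).integral_tendsto_of_countably_generated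
    (integrable_rateV (u := u) (ν := ν) hα s)
  exact this

theorem energyV_mem (hα : α ∈ Icc (0 : ℝ) 1) [IsFiniteMeasure ν] (s ξ : ℝ) :
    energyV α (initialLagr u ν) s ξ ∈ Icc 0 (total ν) := by
  constructor
  · exact integral_nonneg fun η => rateV_nonneg hα s η
  · calc energyV α (initialLagr u ν) s ξ
        ≤ ∫ η in Iic ξ, deriv (energyH ν) η :=
          integral_mono (integrable_rateV hα s).integrableOn
            (integrable_deriv_energyH ν).integrableOn fun η => rateV_le hα s η
      _ = energyH ν ξ := integral_Iic_deriv_energyH ν ξ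
      _ ≤ total ν := energyH_le ν ξ

theorem integral_rateV_mem (hα : α ∈ Icc (0 : ℝ) 1) [IsFiniteMeasure ν] (s : ℝ) :
    ∫ η, rateV α (initialLagr u ν) s η ∈ Icc 0 (total ν) := by
  constructor
  · exact integral_nonneg fun η => rateV_nonneg hα s η
  · exact (integral_mono (integrable_rateV hα s) (integrable_deriv_energyH ν) fun η =>
      rateV_le hα s η).trans (integral_deriv_energyH_le ν)

theorem energyV_antitone (hα : α ∈ Icc (0 : ℝ) 1) [IsFiniteMeasure ν] (ξ : ℝ) :
    Antitone fun s => energyV α (initialLagr u ν) s ξ := fun _ _ h =>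
  integral_mono (integrable_rateV hα _).integrableOn (integrable_rateV hα _).integrableOn
    fun η => rateV_antitone hα η h

/-- The right-hand side of the equation for `U`. -/
noncomputable def accel (α : ℝ) (X : Lagr) (ξ s : ℝ) : ℝ :=
  1 / 2 * energyV α X s ξ - 1 / 4 * limUnder atTop (energyV α X s)

theorem velocityU_eq (X : Lagr) (t ξ : ℝ) :
    velocityU α X t ξ = X.U ξ + ∫ s in (0 : ℝ)..t, accel α X ξ s := rfl

/-- `V(·, ξ)` and `V_∞` may jump in time, but energy is only lost, and monotone functions are
integrable on bounded intervals. -/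
theorem intervalIntegrable_accel (hα : α ∈ Icc (0 : ℝ) 1) [IsFiniteMeasure ν] (ξ a b : ℝ) :
    IntervalIntegrable (accel α (initialLagr u ν) ξ) volume a b := by
  have h1 : IntervalIntegrable (fun s => energyV α (initialLagr u ν) s ξ) volume a b :=
    (energyV_antitone hα ξ).intervalIntegrable
  have h2 : IntervalIntegrable (fun s => limUnder atTop (energyV α (initialLagr u ν) s))
      volume a b := by
    refine Antitone.intervalIntegrable fun s r h => ?_
    rw [limUnder_energyV hα, limUnder_energyV hα]
    exact integral_mono (integrable_rateV hα _) (integrable_rateV hα _)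
      fun η => rateV_antitone hα η h
  exact (h1.const_mul _).sub (h2.const_mul _)

theorem abs_accel_le (hα : α ∈ Icc (0 : ℝ) 1) [IsFiniteMeasure ν] (ξ s : ℝ) :
    |accel α (initialLagr u ν) ξ s| ≤ total ν := by
  obtain ⟨h1, h2⟩ := energyV_mem (u := u) (ν := ν) hα s ξ
  obtain ⟨h3, h4⟩ := integral_rateV_mem (u := u) (ν := ν) hα s
  rw [accel, limUnder_energyV hα, abs_le]
  constructor <;> linarith

theorem abs_velocityU_sub_le (hα : α ∈ Icc (0 : ℝ) 1) [IsFiniteMeasure ν] {t : ℝ} (ht : 0 ≤ t)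
    (ξ : ℝ) : |velocityU α (initialLagr u ν) t ξ - u (charL ν ξ)| ≤ total ν * t := by
  have := intervalIntegral.norm_integral_le_of_norm_le_const (a := 0) (b := t) (C := total ν)
    (f := accel α (initialLagr u ν) ξ) fun s _ => abs_accel_le hα ξ s
  rw [sub_zero, abs_of_nonneg ht] at this
  rw [velocityU_eq]
  simpa [initialLagr] using this

theorem continuous_velocityU_time (hα : α ∈ Icc (0 : ℝ) 1) [IsFiniteMeasure ν] (ξ : ℝ) :
    Continuous fun s => velocityU α (initialLagr u ν) s ξ := by
  simp only [velocityU_eq]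
  exact continuous_const.add
    (intervalIntegral.continuous_primitive (fun a b => intervalIntegrable_accel hα ξ a b) 0)

theorem abs_rateU_le (hα : α ∈ Icc (0 : ℝ) 1) (hc : Compat u ν) {s t : ℝ} (hs : 0 ≤ s)
    (hst : s ≤ t) (η : ℝ) : |rateU α (initialLagr u ν) s η| ≤ 1 + t := by
  have := hc.finite
  have h1 : |deriv (fun ξ => u (charL ν ξ)) η| ≤ 1 := by
    simpa using abs_deriv_le_of_lipschitz hc.comp_charL_lipschitz η
  have h2 := deriv_energyH_nonneg ν η
  have h3 := deriv_energyH_le_one ν η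
  obtain ⟨h4, h5⟩ := sub_elapsed_mem hα (initialLagr u ν) hs η
  have h6 : deriv (energyH ν) η * (s - α * elapsed (initialLagr u ν) s η) ≤ 1 * s :=
    mul_le_mul h3 h5 h4 zero_le_one
  have h7 := mul_nonneg h2 h4
  rw [abs_le] at h1 ⊢
  simp only [rateU, initialLagr] at *
  constructor <;> linarith

theorem intervalIntegrable_of_abs_le {f : ℝ → ℝ} (hf : Measurable f) {C : ℝ}
    (h : ∀ x, |f x| ≤ C) (a b : ℝ) : IntervalIntegrable f volume a b :=
  (intervalIntegrable_const (c := C)).mono_fun hf.aestronglyMeasurable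
    (Eventually.of_forall fun x => by
      simpa using (h x).trans (le_abs_self C))

theorem intervalIntegrable_rateU (hα : α ∈ Icc (0 : ℝ) 1) (hc : Compat u ν) {t : ℝ} (ht : 0 ≤ t)
    (a b : ℝ) : IntervalIntegrable (rateU α (initialLagr u ν) t) volume a b :=
  intervalIntegrable_of_abs_le ((measurable_rateU α _).comp measurable_prodMk_left)
    (abs_rateU_le hα hc ht le_rfl) a b

/-- The term `V_∞` does not depend on the label and cancels in differences. Fubini then moves the
time integral inside, where it acts on `remaining` alone and produces the elapsed time. -/
theorem velocityU_sub (hα : α ∈ Icc (0 : ℝ) 1) (hc : Compat u ν) {t : ℝ} (ht : 0 ≤ t) {a b : ℝ}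
    (hab : a ≤ b) : velocityU α (initialLagr u ν) t b - velocityU α (initialLagr u ν) t a =
      ∫ η in a..b, rateU α (initialLagr u ν) t η := by
  have := hc.finite
  have e1 : (∫ s in (0 : ℝ)..t, accel α (initialLagr u ν) b s) -
      ∫ s in (0 : ℝ)..t, accel α (initialLagr u ν) a s =
      1 / 2 * ∫ s in (0 : ℝ)..t, ∫ η in a..b, rateV α (initialLagr u ν) s η := by
    rw [← intervalIntegral.integral_sub (intervalIntegrable_accel hα b 0 t)
      (intervalIntegrable_accel hα a 0 t), ← intervalIntegral.integral_const_mul]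
    refine intervalIntegral.integral_congr fun s _ => ?_
    simp only [accel]
    rw [← energyV_sub hα]
    ring
  have e2 : ∫ s in (0 : ℝ)..t, ∫ η in a..b, rateV α (initialLagr u ν) s η =
      ∫ η in a..b, deriv (energyH ν) η * (t - α * elapsed (initialLagr u ν) t η) := by
    rw [integral_interval_swap (measurable_rateV α _) ht hab (C := 1) fun s _ η => by
      rw [abs_of_nonneg (rateV_nonneg hα s η)]
      exact (rateV_le hα s η).trans (deriv_energyH_le_one ν η)]
    refine intervalIntegral.integral_congr fun η _ => ?_
    simp only [rateV, intervalIntegral.integral_const_mul, integral_remaining α _ ht]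
    rfl
  have e3 : u (charL ν b) - u (charL ν a) = ∫ η in a..b, deriv (fun ξ => u (charL ν ξ)) η :=
    (integral_deriv_of_lipschitz hc.comp_charL_lipschitz a b).symm
  have i1 := intervalIntegrable_deriv_of_lipschitz hc.comp_charL_lipschitz a b
  have i2 : IntervalIntegrable (fun η => 1 / 2 * (deriv (energyH ν) η *
      (t - α * elapsed (initialLagr u ν) t η))) volume a b := by
    have := (intervalIntegrable_rateU hα hc ht a b).sub i1
    refine this.congr fun η _ => ?_
    simp [rateU, initialLagr]
  rw [velocityU_eq, velocityU_eq, add_sub_add_comm, e1, e2,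
    ← intervalIntegral.integral_const_mul]
  change u (charL ν b) - u (charL ν a) + _ = _
  rw [e3, ← intervalIntegral.integral_add i1 i2]
  rfl

theorem abs_rateY_le (hα : α ∈ Icc (0 : ℝ) 1) (hc : Compat u ν) {t : ℝ} (ht : 0 ≤ t) (η : ℝ) :
    |rateY α (initialLagr u ν) t η| ≤ 1 + t + t ^ 2 := by
  have := hc.finite
  have h0 : |deriv (charL ν) η| ≤ 1 := by
    simpa using abs_deriv_le_of_lipschitz (charL_lipschitz ν) η
  have h1 : |deriv (fun ξ => u (charL ν ξ)) η| ≤ 1 := by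
    simpa using abs_deriv_le_of_lipschitz hc.comp_charL_lipschitz η
  have h2 := deriv_energyH_nonneg ν η
  have h3 := deriv_energyH_le_one ν η
  obtain ⟨h4, h5⟩ := elapsed_mem (initialLagr u ν) ht η
  have h8 : 0 ≤ t ^ 2 - α * elapsed (initialLagr u ν) t η ^ 2 := by
    nlinarith [hα.1, hα.2, mul_le_mul h5 h5 h4 ht, mul_nonneg h4 h4]
  have h9 : t ^ 2 - α * elapsed (initialLagr u ν) t η ^ 2 ≤ t ^ 2 := by
    nlinarith [mul_nonneg hα.1 (sq_nonneg (elapsed (initialLagr u ν) t η))]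
  have h6 : deriv (energyH ν) η * (t ^ 2 - α * elapsed (initialLagr u ν) t η ^ 2) ≤ 1 * t ^ 2 :=
    mul_le_mul h3 h9 h8 zero_le_one
  have h7 := mul_nonneg h2 h8
  rw [abs_le] at h0 h1 ⊢
  have h10 := mul_le_mul_of_nonneg_left h1.1 ht
  have h11 := mul_le_mul_of_nonneg_left h1.2 ht
  simp only [rateY, initialLagr] at *
  constructor <;> linarith [sq_nonneg t]

theorem intervalIntegrable_rateY (hα : α ∈ Icc (0 : ℝ) 1) (hc : Compat u ν) {t : ℝ} (ht : 0 ≤ t)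
    (a b : ℝ) : IntervalIntegrable (rateY α (initialLagr u ν) t) volume a b :=
  intervalIntegrable_of_abs_le ((measurable_rateY α _).comp measurable_prodMk_left)
    (abs_rateY_le hα hc ht) a b

/-- The characteristic `y(t, ·)`. -/
noncomputable def charY (α : ℝ) (u : ℝ → ℝ) (ν : Measure ℝ) (t : ℝ) : ℝ → ℝ :=
  (evolve α t (initialLagr u ν)).y

/-- The velocity `U(t, ·)` along the characteristics. -/
noncomputable def velU (α : ℝ) (u : ℝ → ℝ) (ν : Measure ℝ) (t : ℝ) : ℝ → ℝ :=
  (evolve α t (initialLagr u ν)).U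

theorem charY_eq (t ξ : ℝ) :
    charY α u ν t ξ = charL ν ξ + ∫ s in (0 : ℝ)..t, velocityU α (initialLagr u ν) s ξ := rfl

theorem velU_sub (hα : α ∈ Icc (0 : ℝ) 1) (hc : Compat u ν) {t : ℝ} (ht : 0 ≤ t) {a b : ℝ}
    (hab : a ≤ b) : velU α u ν t b - velU α u ν t a =
      ∫ η in a..b, rateU α (initialLagr u ν) t η :=
  velocityU_sub hα hc ht hab

/-- One more integration in time: `rateU` integrates to `rateY` minus the initial `y_ξ`, after the
same exchange of integrals. -/
theorem charY_sub (hα : α ∈ Icc (0 : ℝ) 1) (hc : Compat u ν) {t : ℝ} (ht : 0 ≤ t) {a b : ℝ}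
    (hab : a ≤ b) : charY α u ν t b - charY α u ν t a =
      ∫ η in a..b, rateY α (initialLagr u ν) t η := by
  have := hc.finite
  have e1 : (∫ s in (0 : ℝ)..t, velocityU α (initialLagr u ν) s b) -
      ∫ s in (0 : ℝ)..t, velocityU α (initialLagr u ν) s a =
      ∫ s in (0 : ℝ)..t, ∫ η in a..b, rateU α (initialLagr u ν) s η := by
    rw [← intervalIntegral.integral_sub
      ((continuous_velocityU_time hα b).intervalIntegrable 0 t)
      ((continuous_velocityU_time hα a).intervalIntegrable 0 t)]
    refine intervalIntegral.integral_congr fun s hs => ?_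
    rw [uIcc_of_le ht] at hs
    exact velocityU_sub hα hc hs.1 hab
  have e2 : ∀ η, ∫ s in (0 : ℝ)..t, rateU α (initialLagr u ν) s η =
      rateY α (initialLagr u ν) t η - deriv (charL ν) η := by
    intro η
    have i : IntervalIntegrable (fun s => 1 / 2 * (deriv (energyH ν) η *
        (s - α * elapsed (initialLagr u ν) s η))) volume 0 t := by
      have hm : Measurable fun s => elapsed (initialLagr u ν) s η :=
        (measurable_elapsed _).comp measurable_prodMk_right
      have : IntervalIntegrable (fun s => elapsed (initialLagr u ν) s η) volume 0 t := by
        refine (intervalIntegrable_const (c := t)).mono_fun' hm.aestronglyMeasurable ?_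
        filter_upwards [ae_restrict_mem measurableSet_uIoc] with s hs
        rw [uIoc_of_le ht] at hs
        obtain ⟨h1, h2⟩ := elapsed_mem (initialLagr u ν) hs.1.le η
        rw [Real.norm_of_nonneg h1]
        exact h2.trans hs.2
      exact (((by simp : IntervalIntegrable (fun s : ℝ => s) volume 0 t).sub
        (this.const_mul α)).const_mul _).const_mul _
    have := intervalIntegral.integral_add (μ := volume) (a := 0) (b := t)
      (intervalIntegrable_const (c := deriv (fun ξ => u (charL ν ξ)) η)) i
    simp only [rateU, rateY]
    refine this.trans ?_
    rw [intervalIntegral.integral_const_mul, intervalIntegral.integral_const_mul,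
      integral_sub_elapsed α _ ht, intervalIntegral.integral_const]
    simp only [initialLagr, smul_eq_mul, sub_zero]
    ring
  rw [charY_eq, charY_eq, add_sub_add_comm, e1, integral_interval_swap (measurable_rateU α _) ht hab
    fun s hs η => abs_rateU_le hα hc hs.1.le hs.2 η]
  simp only [e2]
  rw [intervalIntegral.integral_sub (intervalIntegrable_rateY hα hc ht a b)
    (intervalIntegrable_deriv_of_lipschitz (charL_lipschitz ν) a b),
    integral_deriv_of_lipschitz (charL_lipschitz ν)]
  ring

theorem ae_rate_identities (hα : α ∈ Icc (0 : ℝ) 1) (hc : Compat u ν) {t : ℝ} (ht : 0 ≤ t) :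
    ∀ᵐ η, 0 ≤ rateY α (initialLagr u ν) t η ∧
      rateY α (initialLagr u ν) t η ≤ Real.exp (t / 2) ∧ 0 ≤ rateV α (initialLagr u ν) t η ∧
      rateU α (initialLagr u ν) t η ^ 2 =
        rateY α (initialLagr u ν) t η * rateV α (initialLagr u ν) t η := by
  have := hc.finite
  filter_upwards [ae_deriv_charL_add ν, hc.ae_deriv_sq] with η h1 h2
  exact rate_identities hα _ ht (charL_mono ν).deriv_nonneg (deriv_energyH_nonneg ν η) h1 h2

theorem charY_mono (hα : α ∈ Icc (0 : ℝ) 1) (hc : Compat u ν) {t : ℝ} (ht : 0 ≤ t) :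
    Monotone (charY α u ν t) := by
  intro a b hab
  rw [← sub_nonneg, charY_sub hα hc ht hab]
  refine intervalIntegral.integral_nonneg_of_ae hab ?_
  filter_upwards [ae_rate_identities hα hc ht] with η h using h.1

theorem charY_sub_le (hα : α ∈ Icc (0 : ℝ) 1) (hc : Compat u ν) {t : ℝ} (ht : 0 ≤ t) {a b : ℝ}
    (hab : a ≤ b) : charY α u ν t b - charY α u ν t a ≤ Real.exp (t / 2) * (b - a) := by
  rw [charY_sub hα hc ht hab]
  have := intervalIntegral.integral_mono_ae hab (intervalIntegrable_rateY hα hc ht a b)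
    (intervalIntegrable_const (c := Real.exp (t / 2)))
    ((ae_rate_identities hα hc ht).mono fun η h => h.2.1)
  rwa [intervalIntegral.integral_const, smul_eq_mul, mul_comm] at this

theorem charY_lipschitz (hα : α ∈ Icc (0 : ℝ) 1) (hc : Compat u ν) {t : ℝ} (ht : 0 ≤ t) :
    LipschitzWith (Real.toNNReal (Real.exp (t / 2))) (charY α u ν t) :=
  lipschitzWith_of_sub_le (charY_mono hα hc ht) fun a b h => by
    rw [Real.coe_toNNReal _ (Real.exp_pos _).le]
    exact charY_sub_le hα hc ht h

/-- Cauchy–Schwarz applied to `U_ξ² = y_ξ V_ξ` gives `(ΔU)² ≤ Δy ΔV`, and `ΔV` never exceeds the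
initial energy. Thus `U` is a half-Hölder function of `y`, which produces the square root in the
velocity estimate. -/
theorem sq_velU_sub_le (hα : α ∈ Icc (0 : ℝ) 1) (hc : Compat u ν) {t : ℝ} (ht : 0 ≤ t) {a b : ℝ}
    (hab : a ≤ b) : (velU α u ν t b - velU α u ν t a) ^ 2 ≤
      (charY α u ν t b - charY α u ν t a) * total ν := by
  have := hc.finite
  have h1 := sq_integral_le_mul hab (intervalIntegrable_rateY hα hc ht a b)
    (intervalIntegrable_rateU hα hc ht a b)
    (integrable_rateV (u := u) (ν := ν) hα t).intervalIntegrable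
    ((ae_rate_identities hα hc ht).mono fun η h => ⟨h.1, h.2.2.1, h.2.2.2.le⟩)
  rw [← velU_sub hα hc ht hab, ← charY_sub hα hc ht hab, ← energyV_sub hα] at h1
  refine h1.trans (mul_le_mul_of_nonneg_left ?_ (sub_nonneg.2 (charY_mono hα hc ht hab)))
  linarith [(energyV_mem (u := u) (ν := ν) hα t a).1, (energyV_mem (u := u) (ν := ν) hα t b).2]

theorem abs_velU_sub_le (hα : α ∈ Icc (0 : ℝ) 1) (hc : Compat u ν) {t : ℝ} (ht : 0 ≤ t)
    (a b : ℝ) : |velU α u ν t b - velU α u ν t a| ≤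
      √(total ν) * √|charY α u ν t b - charY α u ν t a| := by
  have key : ∀ a b, a ≤ b → |velU α u ν t b - velU α u ν t a| ≤
      √(total ν) * √|charY α u ν t b - charY α u ν t a| := by
    intro a b hab
    rw [← Real.sqrt_mul (total_nonneg ν), abs_of_nonneg (sub_nonneg.2 (charY_mono hα hc ht hab)),
      mul_comm]
    exact Real.abs_le_sqrt (sq_velU_sub_le hα hc ht hab)
  rcases le_total a b with hab | hab
  · exact key a b hab
  · rw [abs_sub_comm, abs_sub_comm (charY α u ν t b)]
    exact key b a hab

theorem continuous_velU (hα : α ∈ Icc (0 : ℝ) 1) (hc : Compat u ν) {t : ℝ} (ht : 0 ≤ t) :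
    Continuous (velU α u ν t) := by
  have := hc.finite
  refine continuous_of_sq_le (C := Real.exp (t / 2) * total ν) fun a b hab => ?_
  have h1 := sq_velU_sub_le hα hc ht hab
  have h2 := mul_le_mul_of_nonneg_right (charY_sub_le hα hc ht hab) (total_nonneg ν)
  linarith

theorem abs_velU_sub_initial_le (hα : α ∈ Icc (0 : ℝ) 1) [IsFiniteMeasure ν] {t : ℝ} (ht : 0 ≤ t)
    (ξ : ℝ) : |velU α u ν t ξ - u (charL ν ξ)| ≤ total ν * t :=
  abs_velocityU_sub_le hα ht ξ

/-- Since `u` grows at most like `√|x|`, the displacement `y(t) - y(0)` is at most `|y(0)|/2` plus a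
constant. So `y(t)` is continuous and tends to `±∞` at `±∞`. -/
theorem surjective_charY (hα : α ∈ Icc (0 : ℝ) 1) (hc : Compat u ν) {t : ℝ} (ht : 0 ≤ t) :
    Function.Surjective (charY α u ν t) := by
  have := hc.finite
  obtain ⟨K, hK⟩ : ∃ K, ∀ ξ, |charY α u ν t ξ - charL ν ξ| ≤ 1 / 2 * |charL ν ξ| + K := by
    refine ⟨t * (|u 0| + total ν * t) + 1 / 2 * (t ^ 2 * total ν), fun ξ => ?_⟩
    have h1 : |∫ s in (0 : ℝ)..t, velocityU α (initialLagr u ν) s ξ| ≤ (|u (charL ν ξ)| + total ν * t) * t := by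
      have := intervalIntegral.norm_integral_le_of_norm_le_const (a := 0) (b := t)
        (C := |u (charL ν ξ)| + total ν * t) (f := fun s => velocityU α (initialLagr u ν) s ξ) fun s hs => by
          rw [uIoc_of_le ht] at hs
          have h2 := abs_velocityU_sub_le (u := u) (ν := ν) hα hs.1.le ξ
          have h3 := abs_add_le (velocityU α (initialLagr u ν) s ξ - u (charL ν ξ)) (u (charL ν ξ))
          rw [sub_add_cancel] at h3
          have h4 := mul_le_mul_of_nonneg_left hs.2 (total_nonneg ν)
          rw [Real.norm_eq_abs]
          linarith
      rwa [sub_zero, abs_of_nonneg ht] at this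
    have h2 : |u (charL ν ξ)| ≤ |u 0| + √(total ν) * √|charL ν ξ| := by
      have h3 := abs_sub_le_sqrt_of_sq_le hc.sq_le_total 0 (charL ν ξ)
      have h4 := abs_add_le (u (charL ν ξ) - u 0) (u 0)
      rw [sub_add_cancel] at h4
      rw [sub_zero] at h3
      linarith
    -- Young's inequality, from `(t √(total ν) - √|y|)² ≥ 0`.
    have h5 : t * (√(total ν) * √|charL ν ξ|) ≤ 1 / 2 * |charL ν ξ| + 1 / 2 * (t ^ 2 * total ν) := by
      have e1 := Real.sq_sqrt (total_nonneg ν)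
      have e2 := Real.sq_sqrt (abs_nonneg (charL ν ξ))
      nlinarith [sq_nonneg (t * √(total ν) - √|charL ν ξ|)]
    rw [charY_eq, add_sub_cancel_left]
    have h6 := mul_le_mul_of_nonneg_right h2 ht
    linarith
  have hcont := (charY_lipschitz hα hc ht).continuous
  refine hcont.surjective ?_ ?_
  · refine tendsto_atTop_mono' _ (f₁ := fun ξ => 1 / 2 * ξ - (1 / 2 * total ν + K)) ?_ ?_
    · filter_upwards [eventually_ge_atTop (total ν)] with ξ hξ
      have h1 := sub_charL_le ν ξ
      have h2 := (abs_le.1 (hK ξ)).1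
      rw [abs_of_nonneg (by linarith)] at h2
      linarith
    · exact tendsto_atTop_add_const_right _ _ (tendsto_id.const_mul_atTop (by norm_num))
  · refine tendsto_atBot_mono' _ (f₁ := fun ξ => 1 / 2 * ξ + K) ?_ ?_
    · filter_upwards [eventually_le_atBot 0] with ξ hξ
      have h1 := charL_le ν ξ
      have h2 := (abs_le.1 (hK ξ)).2
      rw [abs_of_nonpos (by linarith)] at h2
      linarith
    · exact tendsto_atBot_add_const_right _ _ (tendsto_id.const_mul_atBot (by norm_num))

theorem ae_deriv_charY (hα : α ∈ Icc (0 : ℝ) 1) (hc : Compat u ν) {t : ℝ} (ht : 0 ≤ t) :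
    ∀ᵐ ξ, deriv (charY α u ν t) ξ = rateY α (initialLagr u ν) t ξ := by
  have hl : LocallyIntegrable (rateY α (initialLagr u ν) t) volume :=
    (locallyIntegrable_const (1 + t + t ^ 2)).mono
      ((measurable_rateY α _).comp measurable_prodMk_left).aestronglyMeasurable
      (Eventually.of_forall fun η => by
        simpa using (abs_rateY_le hα hc ht η).trans (le_abs_self _))
  filter_upwards [LocallyIntegrable.ae_hasDerivAt_integral hl] with ξ h
  have h1 := (h 0).const_add (charY α u ν t 0)
  have e : (fun x => charY α u ν t 0 + ∫ η in (0 : ℝ)..x, rateY α (initialLagr u ν) t η) =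
      charY α u ν t := by
    funext x
    rcases le_total 0 x with hx | hx
    · rw [← charY_sub hα hc ht hx]; ring
    · rw [intervalIntegral.integral_symm, ← charY_sub hα hc ht hx]; ring
  rw [e] at h1
  exact h1.deriv

/-- With `h = H_ξ` and `r = U_ξ` at time zero, `y_ξ(t) - 1 = -h + t r + h m / 4` with `0 ≤ m ≤ t²`.
Both `h²` and `r² = (1 - h) h` are at most `h`, so the square is dominated by a multiple of the
integrable `h`. -/
theorem memLp_deriv_charY_sub_one (hα : α ∈ Icc (0 : ℝ) 1) (hc : Compat u ν) {t : ℝ}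
    (ht : 0 ≤ t) : MemLp (fun ξ => deriv (charY α u ν t) ξ - 1) 2 volume := by
  have := hc.finite
  rw [memLp_two_iff_integrable_sq (by fun_prop)]
  -- The constant comes from `(a + b + c)² ≤ 3 (a² + b² + c²)`, the three squares being at most `h`,
  -- `t² h` and `t⁴ h`.
  refine ((integrable_deriv_energyH ν).const_mul (3 * (1 + t ^ 2 + t ^ 4))).mono' (by fun_prop) ?_
  filter_upwards [ae_deriv_charY hα hc ht, ae_deriv_charL_add ν, hc.ae_deriv_sq] with ξ h1 h2 h3
  rw [Real.norm_of_nonneg (sq_nonneg _), h1]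
  have h4 := deriv_energyH_nonneg ν ξ
  have h5 := deriv_energyH_le_one ν ξ
  obtain ⟨h6, h7⟩ := elapsed_mem (initialLagr u ν) ht ξ
  have h8 : 0 ≤ t ^ 2 - α * elapsed (initialLagr u ν) t ξ ^ 2 := by
    nlinarith [hα.1, hα.2, mul_le_mul h7 h7 h6 ht, mul_nonneg h6 h6]
  have h9 : t ^ 2 - α * elapsed (initialLagr u ν) t ξ ^ 2 ≤ t ^ 2 := by
    nlinarith [mul_nonneg hα.1 (sq_nonneg (elapsed (initialLagr u ν) t ξ))]
  simp only [rateY, initialLagr] at *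
  set h := deriv (energyH ν) ξ
  set r := deriv (fun ξ => u (charL ν ξ)) ξ
  set m := t ^ 2 - α * elapsed ⟨charL ν, fun ξ => u (charL ν ξ), energyH ν, energyH ν⟩ t ξ ^ 2
  have hr : r ^ 2 ≤ h := by rw [h3]; nlinarith
  have hh : h ^ 2 ≤ h := by nlinarith
  have hm : m ^ 2 ≤ t ^ 4 := by nlinarith
  have e : deriv (charL ν) ξ = 1 - h := by linarith
  rw [e]
  have k1 : (1 - h + t * r + 1 / 4 * (h * m) - 1) ^ 2 ≤
      3 * (h ^ 2 + t ^ 2 * r ^ 2 + h ^ 2 * m ^ 2) := by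
    nlinarith [sq_nonneg (h + t * r), sq_nonneg (h + 1 / 4 * (h * m)),
      sq_nonneg (t * r - 1 / 4 * (h * m)), sq_nonneg (h * m)]
  have k2 : t ^ 2 * r ^ 2 ≤ t ^ 2 * h := mul_le_mul_of_nonneg_left hr (sq_nonneg t)
  have k3 : h ^ 2 * m ^ 2 ≤ h * t ^ 4 := mul_le_mul hh hm (sq_nonneg m) h4
  linarith

end Evolution

/-! ### Comparison of two solutions -/

/-- For continuous `f` the set where the bound holds is closed and of full measure, hence
everything. The comparison evaluates differences at particular labels, where an almost-everywhere
bound would be useless. -/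
theorem enorm_le_eLpNorm_top {f : ℝ → ℝ} (hf : Continuous f) (x : ℝ) :
    ‖f x‖ₑ ≤ eLpNorm f ∞ volume := by
  have hcl : IsClosed {x | ‖f x‖ₑ ≤ eLpNorm f ∞ volume} :=
    isClosed_le (by fun_prop) continuous_const
  have hae : {x | ‖f x‖ₑ ≤ eLpNorm f ∞ volume} =ᵐ[volume] univ := by
    rw [eventuallyEq_univ]
    filter_upwards [enorm_ae_le_eLpNormEssSup f volume] with x hx
    simpa [eLpNorm_exponent_top] using hx
  have := hcl.ae_eq_univ_iff_eq.1 hae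
  have hx : x ∈ {x | ‖f x‖ₑ ≤ eLpNorm f ∞ volume} := by rw [this]; exact mem_univ x
  exact hx

theorem ofReal_sqrt_mul_sqrt_le (T : ℝ) {d : ℝ} {B : ℝ≥0∞} (h : ENNReal.ofReal d ≤ B) :
    ENNReal.ofReal (√T * √d) ≤ ENNReal.ofReal √T * B ^ (1 / 2 : ℝ) := by
  rw [ENNReal.ofReal_mul (Real.sqrt_nonneg _)]
  gcongr
  rcases le_total d 0 with hd | hd
  · rw [Real.sqrt_eq_zero_of_nonpos hd]; simp
  · rw [Real.sqrt_eq_rpow, ← ENNReal.ofReal_rpow_of_nonneg hd (by norm_num)]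
    gcongr

/-- The symmetric difference of two half-lines. -/
theorem abs_indicator_sub_le (a b x c : ℝ) (hc : 0 ≤ c) :
    ‖(if a < x then c else 0) - (if b < x then c else 0)‖ₑ ≤
      (Ι a b).indicator (fun _ => ENNReal.ofReal c) x := by
  by_cases h : x ∈ Ι a b
  · rw [indicator_of_mem h, ← Real.enorm_eq_ofReal hc]
    split_ifs <;> simp
  · rw [indicator_of_notMem h]
    rw [mem_uIoc, not_or, not_and, not_and, not_le, not_le] at h
    by_cases h1 : a < x <;> by_cases h2 : b < x
    · simp [h1, h2]
    · exact absurd (h.1 h1) h2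
    · exact absurd (h.2 h2) h1
    · simp [h1, h2]

theorem measurableSet_uIoc_prod {f g : ℝ → ℝ} (hf : Measurable f) (hg : Measurable g) :
    MeasurableSet {z : ℝ × ℝ | z.1 ∈ Ι (f z.2) (g z.2)} := by
  have e : {z : ℝ × ℝ | z.1 ∈ Ι (f z.2) (g z.2)} =
      {z : ℝ × ℝ | min (f z.2) (g z.2) < z.1} ∩ {z : ℝ × ℝ | z.1 ≤ max (f z.2) (g z.2)} := rfl
  rw [e]
  exact (measurableSet_lt (by fun_prop) (by fun_prop)).inter
    (measurableSet_le (by fun_prop) (by fun_prop))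

theorem volume_uIoc (a b : ℝ) : volume (Ι a b) = ENNReal.ofReal |a - b| := by
  rw [uIoc, Real.volume_Ioc, max_sub_min_eq_abs, abs_sub_comm]

/-- For fixed `η`, the conditions `f η < x` and `g η < x` disagree only for `x` in an interval of
length `|f η - g η|`. Fubini integrates this length against `h`. -/
theorem lintegral_setIntegral_sub_le {h f g : ℝ → ℝ} (hh : Measurable h) (hi : Integrable h)
    (h0 : ∀ x, 0 ≤ h x) (hf : Measurable f) (hg : Measurable g) {B : ℝ≥0∞}
    (hB : ∀ᵐ η, ENNReal.ofReal |f η - g η| ≤ B) :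
    ∫⁻ x, ‖(∫ η in f ⁻¹' Iio x, h η) - ∫ η in g ⁻¹' Iio x, h η‖ₑ ≤
      ENNReal.ofReal (∫ η, h η) * B := by
  have h1 : ∀ x, ‖(∫ η in f ⁻¹' Iio x, h η) - ∫ η in g ⁻¹' Iio x, h η‖ₑ ≤
      ∫⁻ η, (Ι (f η) (g η)).indicator (fun _ => ENNReal.ofReal (h η)) x := by
    intro x
    have mf := hf (measurableSet_Iio (a := x))
    have mg := hg (measurableSet_Iio (a := x))
    rw [← integral_indicator mf, ← integral_indicator mg,
      ← integral_sub (hi.indicator mf) (hi.indicator mg)]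
    refine (enorm_integral_le_lintegral_enorm _).trans (lintegral_mono fun η => ?_)
    exact abs_indicator_sub_le (f η) (g η) x (h η) (h0 η)
  have hm : Measurable (Function.uncurry fun x η : ℝ =>
      (Ι (f η) (g η)).indicator (fun _ => ENNReal.ofReal (h η)) x) :=
    Measurable.indicator (s := {z : ℝ × ℝ | z.1 ∈ Ι (f z.2) (g z.2)})
      (f := fun z : ℝ × ℝ => ENNReal.ofReal (h z.2)) (by fun_prop) (measurableSet_uIoc_prod hf hg)
  calc ∫⁻ x, ‖(∫ η in f ⁻¹' Iio x, h η) - ∫ η in g ⁻¹' Iio x, h η‖ₑ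
      ≤ ∫⁻ x, ∫⁻ η, (Ι (f η) (g η)).indicator (fun _ => ENNReal.ofReal (h η)) x :=
        lintegral_mono h1
    _ = ∫⁻ η, ∫⁻ x, (Ι (f η) (g η)).indicator (fun _ => ENNReal.ofReal (h η)) x :=
        lintegral_lintegral_swap hm.aemeasurable
    _ ≤ ∫⁻ η, ENNReal.ofReal (h η) * B := by
        refine lintegral_mono_ae ?_
        filter_upwards [hB] with η hη
        rw [lintegral_indicator measurableSet_uIoc, setLIntegral_const, volume_uIoc]
        gcongr
    _ = ENNReal.ofReal (∫ η, h η) * B := by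
        rw [lintegral_mul_const _ (by fun_prop),
          ofReal_integral_eq_lintegral_ofReal hi (Eventually.of_forall h0)]

/-! ### Sections of characteristics and `L¹` estimates for primitives -/

/-- The section picks the least preimage of `x`, which exists since the fibre is closed, nonempty
and bounded below by a preimage of `x - 1`. With this choice `{f < x}` is exactly a half-line. -/
theorem exists_section {f : ℝ → ℝ} (hf : Monotone f) (hc : Continuous f)
    (hs : Function.Surjective f) :
    ∃ c : ℝ → ℝ, StrictMono c ∧ ∀ x, f (c x) = x ∧ f ⁻¹' Iio x = Iio (c x) := by
  have key : ∀ x, ∃ c, f c = x ∧ f ⁻¹' Iio x = Iio c := by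
    intro x
    have hbdd : BddBelow (f ⁻¹' {x}) := by
      obtain ⟨z, hz⟩ := hs (x - 1)
      refine ⟨z, fun w hw => ?_⟩
      by_contra! h
      have := hf h.le
      rw [mem_preimage, mem_singleton_iff] at hw
      linarith
    have hmem : sInf (f ⁻¹' {x}) ∈ f ⁻¹' {x} :=
      (isClosed_singleton.preimage hc).csInf_mem (hs x) hbdd
    refine ⟨sInf (f ⁻¹' {x}), hmem, ?_⟩
    rw [mem_preimage, mem_singleton_iff] at hmem
    ext η
    rw [mem_preimage, mem_Iio, mem_Iio]
    constructor
    · intro h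
      by_contra! h'
      have := hf h'
      linarith
    · intro h
      refine lt_of_le_of_ne ((hf h.le).trans_eq hmem) fun h' => ?_
      exact absurd (csInf_le hbdd (show η ∈ f ⁻¹' {x} from h')) (not_le.2 h)
  choose c hc1 hc2 using key
  refine ⟨c, fun a b hab => ?_, fun x => ⟨hc1 x, hc2 x⟩⟩
  have : c a ∈ f ⁻¹' Iio b := by rw [mem_preimage, hc1, mem_Iio]; exact hab
  rwa [hc2] at this

/-- Since `c⁻¹(s) ⊆ f(s)` and a `K`-Lipschitz map enlarges one-dimensional Hausdorff measure by at
most `K`, the image of Lebesgue measure under `c` is at most `K` times Lebesgue measure. -/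
theorem lintegral_comp_section_le {f c : ℝ → ℝ} {K : NNReal} (hf : LipschitzWith K f)
    (hc : StrictMono c) (hfc : ∀ x, f (c x) = x) {φ : ℝ → ℝ≥0∞} (hφ : Measurable φ) :
    ∫⁻ x, φ (c x) ≤ K * ∫⁻ ξ, φ ξ := by
  have hcm : Measurable c := hc.monotone.measurable
  have hle : Measure.map c volume ≤ (K : ℝ≥0∞) • (volume : Measure ℝ) := by
    refine Measure.le_iff.2 fun s hs => ?_
    rw [Measure.map_apply hcm hs]
    have h1 : c ⁻¹' s ⊆ f '' s := fun x hx => ⟨c x, hx, hfc x⟩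
    have h2 := hf.hausdorffMeasure_image_le (d := 1) zero_le_one s
    rw [hausdorffMeasure_real, ENNReal.rpow_one] at h2
    exact (measure_mono h1).trans h2
  rw [← lintegral_map hφ hcm, ← smul_eq_mul, ← lintegral_smul_measure]
  exact lintegral_mono' hle le_rfl

/-- Here `|H - H'| = |y - y'|`, so the left side is the area between the graphs of two
characteristics. Sliced the other way, `x` between `y(ξ)` and `y'(ξ)` forces `ξ` between `G(x) + x`
and `G'(x) + x`. -/
theorem lintegral_energyH_sub_le (ν ν' : Measure ℝ) [IsFiniteMeasure ν] [IsFiniteMeasure ν'] :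
    ∫⁻ ξ, ‖energyH ν ξ - energyH ν' ξ‖ₑ ≤ ∫⁻ x, ENNReal.ofReal |prim ν x - prim ν' x| := by
  have hm := (charL_lipschitz ν).continuous.measurable
  have hm' := (charL_lipschitz ν').continuous.measurable
  have hmeas : Measurable (Function.uncurry fun x ξ : ℝ =>
      (Ι (charL ν ξ) (charL ν' ξ)).indicator (1 : ℝ → ℝ≥0∞) x) :=
    Measurable.indicator (s := {z : ℝ × ℝ | z.1 ∈ Ι (charL ν z.2) (charL ν' z.2)})
      (f := 1) measurable_const (measurableSet_uIoc_prod hm hm')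
  calc ∫⁻ ξ, ‖energyH ν ξ - energyH ν' ξ‖ₑ
      = ∫⁻ ξ, ∫⁻ x, (Ι (charL ν ξ) (charL ν' ξ)).indicator (1 : ℝ → ℝ≥0∞) x := by
        refine lintegral_congr fun ξ => ?_
        rw [lintegral_indicator_one measurableSet_uIoc, volume_uIoc, abs_sub_comm,
          Real.enorm_eq_ofReal_abs]
        simp only [energyH]
        congr 2; ring
    _ = ∫⁻ x, ∫⁻ ξ, (Ι (charL ν ξ) (charL ν' ξ)).indicator (1 : ℝ → ℝ≥0∞) x :=
        (lintegral_lintegral_swap hmeas.aemeasurable).symm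
    _ ≤ ∫⁻ x, ENNReal.ofReal |prim ν x - prim ν' x| := by
        refine lintegral_mono fun x => ?_
        have e : ∀ ξ, (Ι (charL ν ξ) (charL ν' ξ)).indicator (1 : ℝ → ℝ≥0∞) x ≤
            (Icc (min (prim ν x + x) (prim ν' x + x))
              (max (prim ν x + x) (prim ν' x + x))).indicator 1 ξ := by
          intro ξ
          by_cases h : x ∈ Ι (charL ν ξ) (charL ν' ξ)
          · rw [indicator_of_mem h, indicator_of_mem]
            · simp
            · rw [mem_uIoc, charL_lt_iff, charL_lt_iff, le_charL_iff, le_charL_iff] at h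
              rcases h with ⟨h1, h2⟩ | ⟨h1, h2⟩
              · exact ⟨(min_le_right _ _).trans h2, h1.le.trans (le_max_left _ _)⟩
              · exact ⟨(min_le_left _ _).trans h2, h1.le.trans (le_max_right _ _)⟩
          · rw [indicator_of_notMem h]; exact zero_le
        refine (lintegral_mono e).trans ?_
        rw [lintegral_indicator_one measurableSet_Icc, Real.volume_Icc, max_sub_min_eq_abs,
          abs_sub_comm]
        apply le_of_eq
        congr 2; ring

/-- By Fubini, each point `z` lies in the window around `x` for a set of `x` of length `2 d`. -/
theorem lintegral_prim_window (ν : Measure ℝ) [IsFiniteMeasure ν] {d : ℝ} (hd : 0 ≤ d) :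
    ∫⁻ x, ENNReal.ofReal (prim ν (x + d) - prim ν (x - d)) ≤
      ENNReal.ofReal (2 * d * total ν) := by
  have hmeas : Measurable (Function.uncurry fun x z : ℝ =>
      (Ico (x - d) (x + d)).indicator (1 : ℝ → ℝ≥0∞) z) := by
    refine Measurable.indicator (s := {z : ℝ × ℝ | z.2 ∈ Ico (z.1 - d) (z.1 + d)})
      (f := 1) measurable_const ?_
    exact (measurableSet_le (f := fun z : ℝ × ℝ => z.1 - d) (by fun_prop) (by fun_prop)).inter
      (measurableSet_lt (g := fun z : ℝ × ℝ => z.1 + d) (by fun_prop) (by fun_prop))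
  calc ∫⁻ x, ENNReal.ofReal (prim ν (x + d) - prim ν (x - d))
      = ∫⁻ x, ∫⁻ z, (Ico (x - d) (x + d)).indicator (1 : ℝ → ℝ≥0∞) z ∂ν := by
        refine lintegral_congr fun x => ?_
        rw [lintegral_indicator_one measurableSet_Ico, prim_sub_prim ν (by linarith),
          ENNReal.ofReal_toReal (measure_ne_top _ _)]
    _ = ∫⁻ z, (∫⁻ x, (Ico (x - d) (x + d)).indicator (1 : ℝ → ℝ≥0∞) z) ∂ν :=
        lintegral_lintegral_swap hmeas.aemeasurable
    _ = ∫⁻ z, ENNReal.ofReal (2 * d) ∂ν := by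
        refine lintegral_congr fun z => ?_
        have e : ∀ x, (Ico (x - d) (x + d)).indicator (1 : ℝ → ℝ≥0∞) z =
            (Ioc (z - d) (z + d)).indicator 1 x := by
          intro x
          have : z ∈ Ico (x - d) (x + d) ↔ x ∈ Ioc (z - d) (z + d) := by
            rw [mem_Ico, mem_Ioc]
            constructor <;> rintro ⟨h1, h2⟩ <;> constructor <;> linarith
          simp only [indicator_apply, this, Pi.one_apply]
        simp only [e]
        rw [lintegral_indicator_one measurableSet_Ioc, Real.volume_Ioc]
        congr 1; ring
    _ ≤ ENNReal.ofReal (2 * d * total ν) := by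
        rw [lintegral_const, ENNReal.ofReal_mul (p := 2 * d) (by linarith), total,
          ENNReal.ofReal_toReal (measure_ne_top _ _)]

/-! ### Estimates between the solutions of two compatible data -/

section Compare

variable {α : ℝ} {u u' : ℝ → ℝ} {ν ν' : Measure ℝ}

/-- The solution in Eulerian coordinates. -/
noncomputable def solution (α : ℝ) (u : ℝ → ℝ) (ν : Measure ℝ) (t : ℝ) : Euler :=
  mapM (evolve α t (initialLagr u ν))

theorem prim_solution (hα : α ∈ Icc (0 : ℝ) 1) (hc : Compat u ν) {t : ℝ} (ht : 0 ≤ t) (x : ℝ) :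
    prim (solution α u ν t).ν x = ∫ η in charY α u ν t ⁻¹' Iio x, deriv (energyH ν) η := by
  have := hc.finite
  have hm := (charY_lipschitz hα hc ht).continuous.measurable
  change ((Measure.map (charY α u ν t) (volume.withDensity
    (fun ξ => ENNReal.ofReal (deriv (energyH ν) ξ)))) (Iio x)).toReal = _
  rw [Measure.map_apply hm measurableSet_Iio, withDensity_apply _ (hm measurableSet_Iio),
    integral_eq_lintegral_of_nonneg_ae (Eventually.of_forall (deriv_energyH_nonneg ν))
      (by fun_prop)]

theorem eLpNorm_solution_u_sub_le (hα : α ∈ Icc (0 : ℝ) 1) (hc : Compat u ν) (hc' : Compat u' ν')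
    {t : ℝ} (ht : 0 ≤ t) :
    eLpNorm (fun x => (solution α u ν t).u x - (solution α u' ν' t).u x) ∞ volume ≤
      eLpNorm (fun ξ => velU α u ν t ξ - velU α u' ν' t ξ) ∞ volume +
        ENNReal.ofReal √(total ν) *
          eLpNorm (fun ξ => charY α u ν t ξ - charY α u' ν' t ξ) ∞ volume ^ (1 / 2 : ℝ) := by
  rw [eLpNorm_exponent_top (f := fun x => (solution α u ν t).u x - (solution α u' ν' t).u x)]
  refine eLpNormEssSup_le_of_ae_enorm_bound (Eventually.of_forall fun x => ?_)
  set ξ := Function.invFun (charY α u ν t) x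
  set η := Function.invFun (charY α u' ν' t) x
  have hξ : charY α u ν t ξ = x := Function.invFun_eq (surjective_charY hα hc ht x)
  have hη : charY α u' ν' t η = x := Function.invFun_eq (surjective_charY hα hc' ht x)
  change ‖velU α u ν t ξ - velU α u' ν' t η‖ₑ ≤ _
  have h1 := enorm_le_eLpNorm_top
    ((continuous_velU hα hc ht).sub (continuous_velU hα hc' ht)) η
  have h2 := enorm_le_eLpNorm_top ((charY_lipschitz hα hc ht).continuous.sub
    (charY_lipschitz hα hc' ht).continuous) η
  have h3 := abs_velU_sub_le hα hc ht η ξ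
  -- Both labels sit at `x`, so `y(ξ) = y'(η)` and the Hölder bound compares the two characteristics
  -- at the single label `η`.
  rw [hξ, ← hη, abs_sub_comm (charY α u' ν' t η)] at h3
  rw [Real.enorm_eq_ofReal_abs] at h2
  calc ‖velU α u ν t ξ - velU α u' ν' t η‖ₑ
      = ‖(velU α u ν t η - velU α u' ν' t η) + (velU α u ν t ξ - velU α u ν t η)‖ₑ := by
        congr 1; ring
    _ ≤ ‖velU α u ν t η - velU α u' ν' t η‖ₑ + ‖velU α u ν t ξ - velU α u ν t η‖ₑ :=
        enorm_add_le _ _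
    _ ≤ _ := by
        refine add_le_add h1 ?_
        rw [Real.enorm_eq_ofReal_abs]
        exact (ENNReal.ofReal_le_ofReal h3).trans (ofReal_sqrt_mul_sqrt_le _ h2)

/-- The intermediate term integrates the density `H_ξ` of the first solution over the domain `{y' <
x}` of the second. One difference then only moves the domain; the other only changes the density,
and becomes `H - H'` at a section of `y'`. -/
theorem eLpNorm_solution_prim_sub_le (hα : α ∈ Icc (0 : ℝ) 1) (hc : Compat u ν)
    (hc' : Compat u' ν') {t : ℝ} (ht : 0 ≤ t) :
    eLpNorm (fun x => prim (solution α u ν t).ν x - prim (solution α u' ν' t).ν x) 1 volume ≤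
      ENNReal.ofReal (total ν) *
          eLpNorm (fun ξ => charY α u ν t ξ - charY α u' ν' t ξ) ∞ volume +
        ENNReal.ofReal (Real.exp (t / 2)) * ∫⁻ x, ENNReal.ofReal |prim ν x - prim ν' x| := by
  have := hc.finite
  have := hc'.finite
  have hL := charY_lipschitz hα hc ht
  have hL' := charY_lipschitz hα hc' ht
  obtain ⟨c, hcm, hcs⟩ := exists_section (charY_mono hα hc' ht) hL'.continuous
    (surjective_charY hα hc' ht)
  have hB : ∀ᵐ η, ENNReal.ofReal |charY α u ν t η - charY α u' ν' t η| ≤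
      eLpNorm (fun ξ => charY α u ν t ξ - charY α u' ν' t ξ) ∞ volume :=
    Eventually.of_forall fun η => by
      have h2 := enorm_le_eLpNorm_top (hL.continuous.sub hL'.continuous) η
      rwa [Real.enorm_eq_ofReal_abs] at h2
  have h1 := lintegral_setIntegral_sub_le (measurable_deriv _) (integrable_deriv_energyH ν)
    (deriv_energyH_nonneg ν) hL.continuous.measurable hL'.continuous.measurable hB
  have hsec : ∀ (ρ : Measure ℝ) [IsFiniteMeasure ρ] (x : ℝ),
      ∫ η in charY α u' ν' t ⁻¹' Iio x, deriv (energyH ρ) η = energyH ρ (c x) := by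
    intro ρ _ x
    rw [(hcs x).2, ← integral_Iic_eq_integral_Iio, integral_Iic_deriv_energyH]
  have hφ : Measurable fun ξ => ‖energyH ν ξ - energyH ν' ξ‖ₑ :=
    ((energyH_mono ν).measurable.sub (energyH_mono ν').measurable).enorm
  have h2 := lintegral_comp_section_le hL' hcm (fun x => (hcs x).1) hφ
  have h3 := lintegral_energyH_sub_le ν ν'
  rw [eLpNorm_one_eq_lintegral_enorm]
  calc ∫⁻ x, ‖prim (solution α u ν t).ν x - prim (solution α u' ν' t).ν x‖ₑ
      ≤ ∫⁻ x, (‖(∫ η in charY α u ν t ⁻¹' Iio x, deriv (energyH ν) η) -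
          ∫ η in charY α u' ν' t ⁻¹' Iio x, deriv (energyH ν) η‖ₑ +
          ‖energyH ν (c x) - energyH ν' (c x)‖ₑ) := by
        refine lintegral_mono fun x => ?_
        rw [prim_solution hα hc ht, prim_solution hα hc' ht, ← hsec ν x, ← hsec ν' x]
        refine le_trans (le_of_eq ?_) (enorm_add_le _ _)
        congr 1; ring
    _ = (∫⁻ x, ‖(∫ η in charY α u ν t ⁻¹' Iio x, deriv (energyH ν) η) -
          ∫ η in charY α u' ν' t ⁻¹' Iio x, deriv (energyH ν) η‖ₑ) +
          ∫⁻ x, ‖energyH ν (c x) - energyH ν' (c x)‖ₑ :=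
        lintegral_add_right _ (hφ.comp hcm.monotone.measurable)
    _ ≤ _ := by
        refine add_le_add (h1.trans ?_) (h2.trans ?_)
        · gcongr
          exact integral_deriv_energyH_le ν
        · change ENNReal.ofReal (Real.exp (t / 2)) * _ ≤ _
          gcongr

/-- Each velocity stays within `total · t` of its initial value. The initial values differ by `u -
u'` at one point plus a Hölder increment of `u` over `|y - y'| ≤ total ν + total ν'`. The bound is
uniform over `[0, t]` so that it can be integrated for `y`. -/
theorem exists_bound_velU_sub (hα : α ∈ Icc (0 : ℝ) 1) (hc : Compat u ν) (hc' : Compat u' ν') {C : ℝ}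
    (hC : ∀ x, |u x - u' x| ≤ C) :
    ∃ D, ∀ s t, 0 ≤ s → s ≤ t → ∀ ξ, |velU α u ν s ξ - velU α u' ν' s ξ| ≤
      D + (total ν + total ν') * t := by
  have := hc.finite
  have := hc'.finite
  refine ⟨C + √(total ν) * √(total ν + total ν'), fun s t hs hst ξ => ?_⟩
  have h1 := abs_velU_sub_initial_le (u := u) (ν := ν) hα hs ξ
  have h2 := abs_velU_sub_initial_le (u := u') (ν := ν') hα hs ξ
  have h3 := abs_sub_le_sqrt_of_sq_le hc.sq_le_total (charL ν' ξ) (charL ν ξ)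
  have h4 : |charL ν ξ - charL ν' ξ| ≤ total ν + total ν' := by
    have a1 := charL_le ν ξ
    have a2 := charL_le ν' ξ
    have a3 := sub_charL_le ν ξ
    have a4 := sub_charL_le ν' ξ
    have a5 := total_nonneg ν
    have a6 := total_nonneg ν'
    rw [abs_le]; constructor <;> linarith
  have h5 : √(total ν) * √|charL ν ξ - charL ν' ξ| ≤ √(total ν) * √(total ν + total ν') := by
    gcongr
  have h6 := hC (charL ν' ξ)
  have h7 := mul_le_mul_of_nonneg_left hst (total_nonneg ν)
  have h8 := mul_le_mul_of_nonneg_left hst (total_nonneg ν')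
  rw [abs_le] at h1 h2 h3 h6 ⊢
  constructor <;> linarith

theorem memLp_top_velU_sub (hα : α ∈ Icc (0 : ℝ) 1) (hc : Compat u ν) (hc' : Compat u' ν') {C : ℝ}
    (hC : ∀ x, |u x - u' x| ≤ C) {t : ℝ} (ht : 0 ≤ t) :
    MemLp (fun ξ => velU α u ν t ξ - velU α u' ν' t ξ) ∞ volume := by
  obtain ⟨D, hD⟩ := exists_bound_velU_sub hα hc hc' hC
  exact memLp_top_of_bound
    ((continuous_velU hα hc ht).sub (continuous_velU hα hc' ht)).aestronglyMeasurable _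
    (Eventually.of_forall fun ξ => hD t t ht le_rfl ξ)

theorem memLp_top_charY_sub (hα : α ∈ Icc (0 : ℝ) 1) (hc : Compat u ν) (hc' : Compat u' ν')
    {C : ℝ} (hC : ∀ x, |u x - u' x| ≤ C) {t : ℝ} (ht : 0 ≤ t) :
    MemLp (fun ξ => charY α u ν t ξ - charY α u' ν' t ξ) ∞ volume := by
  have := hc.finite
  have := hc'.finite
  obtain ⟨D, hD⟩ := exists_bound_velU_sub hα hc hc' hC
  refine memLp_top_of_bound ((charY_lipschitz hα hc ht).continuous.sub
    (charY_lipschitz hα hc' ht).continuous).aestronglyMeasurable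
    (total ν + total ν' + (D + (total ν + total ν') * t) * t) (Eventually.of_forall fun ξ => ?_)
  have h1 : charY α u ν t ξ - charY α u' ν' t ξ = (charL ν ξ - charL ν' ξ) +
      ∫ s in (0 : ℝ)..t, (velocityU α (initialLagr u ν) s ξ -
        velocityU α (initialLagr u' ν') s ξ) := by
    rw [charY_eq, charY_eq, intervalIntegral.integral_sub
      ((continuous_velocityU_time hα ξ).intervalIntegrable 0 t)
      ((continuous_velocityU_time hα ξ).intervalIntegrable 0 t)]
    ring
  have h2 := intervalIntegral.norm_integral_le_of_norm_le_const (a := 0) (b := t)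
    (C := D + (total ν + total ν') * t) (f := fun s => velocityU α (initialLagr u ν) s ξ -
        velocityU α (initialLagr u' ν') s ξ) fun s hs => by
      rw [uIoc_of_le ht] at hs
      exact hD s t hs.1.le hs.2 ξ
  rw [sub_zero, abs_of_nonneg ht] at h2
  have a1 := charL_le ν ξ
  have a2 := charL_le ν' ξ
  have a3 := sub_charL_le ν ξ
  have a4 := sub_charL_le ν' ξ
  have a5 := total_nonneg ν
  have a6 := total_nonneg ν'
  rw [h1]
  refine (norm_add_le _ _).trans (add_le_add ?_ h2)
  rw [Real.norm_eq_abs, abs_le]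
  constructor <;> linarith

theorem memLp_deriv_charY_sub (hα : α ∈ Icc (0 : ℝ) 1) (hc : Compat u ν) (hc' : Compat u' ν')
    {t : ℝ} (ht : 0 ≤ t) :
    MemLp (fun ξ => deriv (charY α u ν t) ξ - deriv (charY α u' ν' t) ξ) 2 volume := by
  have := (memLp_deriv_charY_sub_one hα hc ht).sub (memLp_deriv_charY_sub_one hα hc' ht)
  refine this.ae_eq (Eventually.of_forall fun ξ => ?_)
  simp

end Compare

/-! ### Data that agree at the even grid points -/

theorem exists_grid {dx : ℝ} (hdx : 0 < dx) (x : ℝ) :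
    ∃ j : ℤ, 2 * j * dx ≤ x ∧ x ≤ (2 * j + 2) * dx := by
  refine ⟨⌊x / (2 * dx)⌋, ?_, ?_⟩
  · have := Int.floor_le (x / (2 * dx))
    rw [le_div_iff₀ (by positivity)] at this
    linarith
  · have := (Int.lt_floor_add_one (x / (2 * dx))).le
    rw [div_le_iff₀ (by positivity)] at this
    linarith

/-- Two monotone functions with common values at the ends of a double cell differ there by at most
the increment of either over the cell. The cell lies in the window of half-width `2 dx` around `x`,
whence the constant `4 = 2 · 2`. -/
theorem lintegral_prim_sub_le {ν ν' : Measure ℝ} [IsFiniteMeasure ν] [IsFiniteMeasure ν'] {dx : ℝ}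
    (hdx : 0 < dx) (hG : ∀ j : ℤ, prim ν (2 * j * dx) = prim ν' (2 * j * dx)) :
    ∫⁻ x, ENNReal.ofReal |prim ν x - prim ν' x| ≤ ENNReal.ofReal (4 * total ν * dx) := by
  have h1 := lintegral_prim_window ν (show (0 : ℝ) ≤ 2 * dx by positivity)
  rw [show 2 * (2 * dx) * total ν = 4 * total ν * dx by ring] at h1
  refine (lintegral_mono fun x => ENNReal.ofReal_le_ofReal ?_).trans h1
  obtain ⟨j, hj1, hj2⟩ := exists_grid hdx x
  have e := hG (j + 1)
  push_cast at e
  rw [show 2 * ((j : ℝ) + 1) * dx = (2 * j + 2) * dx by ring] at e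
  have a1 := prim_mono ν hj1
  have a2 := prim_mono ν hj2
  have a3 := prim_mono ν' hj1
  have a4 := prim_mono ν' hj2
  have a5 := prim_mono ν (show (2 * j + 2) * dx ≤ x + 2 * dx by linarith)
  have a6 := prim_mono ν (show x - 2 * dx ≤ 2 * j * dx by linarith)
  rw [← hG j] at a3
  rw [← e] at a4
  rw [abs_le]
  constructor <;> linarith

theorem exists_bound_sub {u u' : ℝ → ℝ} {ν ν' : Measure ℝ} (hc : Compat u ν) (hc' : Compat u' ν')
    {dx : ℝ} (hdx : 0 < dx) (hu : ∀ j : ℤ, u (2 * j * dx) = u' (2 * j * dx)) :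
    ∃ C, ∀ x, |u x - u' x| ≤ C := by
  refine ⟨√(total ν) * √(2 * dx) + √(total ν') * √(2 * dx), fun x => ?_⟩
  obtain ⟨j, hj1, hj2⟩ := exists_grid hdx x
  have h1 := abs_sub_le_sqrt_of_sq_le hc.sq_le_total (2 * j * dx) x
  have h2 := abs_sub_le_sqrt_of_sq_le hc'.sq_le_total (2 * j * dx) x
  have h3 : √|x - 2 * j * dx| ≤ √(2 * dx) := by
    rw [abs_of_nonneg (by linarith)]
    exact Real.sqrt_le_sqrt (by linarith)
  have h4 := mul_le_mul_of_nonneg_left h3 (Real.sqrt_nonneg (total ν))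
  have h5 := mul_le_mul_of_nonneg_left h3 (Real.sqrt_nonneg (total ν'))
  rw [← hu j] at h2
  rw [abs_le] at h1 h2 ⊢
  constructor <;> linarith

/-! ### The exact datum -/

/-- Stieltjes functions are right-continuous, primitives `x ↦ m((-∞, x))` left-continuous. The left
limit of the right-continuous version recovers the primitive. -/
theorem leftLim_stieltjesFunction {F : ℝ → ℝ} (hF : Monotone F)
    (hl : ∀ x, Tendsto F (𝓝[<] x) (𝓝 (F x))) (x : ℝ) :
    Function.leftLim hF.stieltjesFunction x = F x := by
  change Function.leftLim (Function.rightLim F) x = F x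
  rw [leftLim_rightLim (hF.tendsto_leftLim x), leftLim_eq_of_tendsto (hl x)]

theorem hasDerivAt_prim_ae (ν : Measure ℝ) [IsFiniteMeasure ν] :
    ∀ᵐ x, HasDerivAt (prim ν) (ν.rnDeriv volume x).toReal x := by
  have hm := prim_mono ν
  have e : hm.stieltjesFunction.measure = ν := by
    refine Measure.ext_of_Ico _ _ fun a b hab => ?_
    rw [StieltjesFunction.measure_Ico, leftLim_stieltjesFunction hm (tendsto_prim_nhdsLT ν),
      leftLim_stieltjesFunction hm (tendsto_prim_nhdsLT ν), prim_sub_prim ν hab.le,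
      ENNReal.ofReal_toReal (measure_ne_top _ _)]
  have := hm.ae_hasDerivAt
  rwa [e] at this

theorem exists_measure_of_monotone {F : ℝ → ℝ} (hF : Monotone F)
    (hl : ∀ x, Tendsto F (𝓝[<] x) (𝓝 (F x))) (h0 : Tendsto F atBot (𝓝 0)) {C : ℝ}
    (hC : ∀ x, F x ≤ C) :
    ∃ m : Measure ℝ, IsFiniteMeasure m ∧ ∀ x, m (Iio x) = ENNReal.ofReal (F x) := by
  have hr : Tendsto hF.stieltjesFunction atBot (𝓝 0) := tendsto_rightLim_atBot_of_tendsto h0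
  refine ⟨hF.stieltjesFunction.measure, ?_, fun x => ?_⟩
  · refine StieltjesFunction.isFiniteMeasure_of_forall_abs_le _ (C := C) fun x => ?_
    have h1 : (0 : ℝ) ≤ F x := hF.le_of_tendsto h0 x
    have h2 : F x ≤ hF.stieltjesFunction x := hF.le_rightLim le_rfl
    have h3 : hF.stieltjesFunction x ≤ F (x + 1) := hF.rightLim_le (by linarith)
    rw [abs_of_nonneg (by linarith)]
    exact h3.trans (hC _)
  · rw [StieltjesFunction.measure_Iio _ hr, leftLim_stieltjesFunction hF hl, sub_zero]

theorem measureOf_spec {F : ℝ → ℝ} (hF : Monotone F)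
    (hl : ∀ x, Tendsto F (𝓝[<] x) (𝓝 (F x))) (h0 : Tendsto F atBot (𝓝 0)) {C : ℝ}
    (hC : ∀ x, F x ≤ C) : IsFiniteMeasure (measureOf F) ∧ prim (measureOf F) = F := by
  have h := exists_measure_of_monotone hF hl h0 hC
  have e : measureOf F = h.choose := dif_pos h
  rw [e]
  refine ⟨h.choose_spec.1, funext fun x => ?_⟩
  rw [prim, h.choose_spec.2, ENNReal.toReal_ofReal (hF.le_of_tendsto h0 x)]

/-- The weak derivative is `g + a χ⁺' + b χ⁻'`, and Lebesgue differentiation makes it the pointwise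
derivative almost everywhere. The quantity `deriv u` in `energyDensity` is thereby the true density.
-/
theorem MemE2.exists_primitive {u : ℝ → ℝ} (h : MemE2 u) :
    ∃ w : ℝ → ℝ, LocallyIntegrable w volume ∧ (∀ a b, u b - u a = ∫ x in a..b, w x) ∧
      ∀ᵐ x, HasDerivAt u (w x) x := by
  suffices H : ∃ w : ℝ → ℝ, LocallyIntegrable w volume ∧ ∀ a b, u b - u a = ∫ x in a..b, w x by
    obtain ⟨w, hw, hu⟩ := H
    refine ⟨w, hw, hu, ?_⟩
    filter_upwards [LocallyIntegrable.ae_hasDerivAt_integral hw] with x hx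
    have e : (fun x => u 0 + ∫ z in (0 : ℝ)..x, w z) = u := by
      funext z; rw [← hu 0 z]; ring
    have h1 := (hx 0).const_add (u 0)
    rwa [e] at h1
  obtain ⟨χp, χm, hχ, a, b, -, g, hg, hgi⟩ := h
  have hp : Continuous (deriv χp) := hχ.smooth_p.continuous_deriv (by simp)
  have hm : Continuous (deriv χm) := hχ.smooth_m.continuous_deriv (by simp)
  have hgl : LocallyIntegrable g volume := hg.locallyIntegrable (by norm_num)
  have hk : LocallyIntegrable (fun x => a * deriv χp x + b * deriv χm x) volume :=
    (by fun_prop : Continuous fun x => a * deriv χp x + b * deriv χm x).locallyIntegrable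
  refine ⟨fun x => g x + (a * deriv χp x + b * deriv χm x), hgl.add hk, fun c d => ?_⟩
  have i1 : IntervalIntegrable g volume c d :=
    (hgl.integrableOn_isCompact isCompact_uIcc).intervalIntegrable
  have ip := hp.intervalIntegrable (μ := volume) c d
  have im := hm.intervalIntegrable (μ := volume) c d
  rw [intervalIntegral.integral_add i1 ((ip.const_mul a).add (im.const_mul b)),
    intervalIntegral.integral_add (ip.const_mul a) (im.const_mul b),
    intervalIntegral.integral_const_mul, intervalIntegral.integral_const_mul,
    intervalIntegral.integral_deriv_eq_sub
      (fun x _ => hχ.smooth_p.differentiable (by simp) x) ip,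
    intervalIntegral.integral_deriv_eq_sub
      (fun x _ => hχ.smooth_m.differentiable (by simp) x) im, ← hgi c d]
  ring

theorem acPart_le (μ : Measure ℝ) : acPart μ ≤ μ := Measure.withDensity_rnDeriv_le μ volume

theorem prim_acPart_add_singPart (μ : Measure ℝ) [IsFiniteMeasure μ] (x : ℝ) :
    prim (acPart μ) x + prim (singPart μ) x = prim μ x := by
  have h : singPart μ + acPart μ = μ := Measure.singularPart_add_rnDeriv μ volume
  have h1 : μ (Iio x) = singPart μ (Iio x) + acPart μ (Iio x) := by
    conv_lhs => rw [← h]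
    rfl
  have f1 : singPart μ (Iio x) ≠ ∞ :=
    ((Measure.singularPart_le μ volume _).trans_lt (measure_lt_top μ _)).ne
  have f2 : acPart μ (Iio x) ≠ ∞ := ((acPart_le μ _).trans_lt (measure_lt_top μ _)).ne
  rw [prim, prim, prim, h1, ENNReal.toReal_add f1 f2, add_comm]

theorem isFiniteMeasure_of_le {μ ν : Measure ℝ} [IsFiniteMeasure ν] (h : μ ≤ ν) :
    IsFiniteMeasure μ := ⟨(h _).trans_lt (measure_lt_top ν _)⟩

theorem MemE2.sq_sub_le {u : ℝ → ℝ} (h : MemE2 u) [IsFiniteMeasure (energyDensity u)] {a b : ℝ}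
    (hab : a ≤ b) :
    (u b - u a) ^ 2 ≤ (b - a) * (prim (energyDensity u) b - prim (energyDensity u) a) := by
  obtain ⟨w, hw, hu, hd'⟩ := h.exists_primitive
  have hd : ∀ᵐ x, deriv u x = w x := hd'.mono fun x hx => hx.deriv
  have hi : IntervalIntegrable (deriv u) volume a b :=
    (hw.integrableOn_isCompact isCompact_uIcc).intervalIntegrable.congr_ae
      (ae_restrict_of_ae (hd.mono fun x hx => hx.symm))
  have hsq : Integrable (fun x => deriv u x ^ 2) volume := by
    refine ⟨by fun_prop, ?_⟩
    rw [hasFiniteIntegral_iff_ofReal (Eventually.of_forall fun x => sq_nonneg _)]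
    have := measure_lt_top (energyDensity u) univ
    rwa [energyDensity, withDensity_apply _ MeasurableSet.univ, Measure.restrict_univ] at this
  have h1 := sq_integral_le_mul hab (p := fun _ => 1) (by simp) hi hsq.intervalIntegrable
    (Eventually.of_forall fun x => ⟨zero_le_one, sq_nonneg _, by simp⟩)
  have e1 : ∫ x in a..b, deriv u x = u b - u a := by
    rw [hu a b]
    exact intervalIntegral.integral_congr_ae (hd.mono fun x hx _ => hx)
  have e2 : ∫ x in a..b, deriv u x ^ 2 =
      prim (energyDensity u) b - prim (energyDensity u) a := by
    rw [prim_sub_prim _ hab, energyDensity, withDensity_apply _ measurableSet_Ico,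
      intervalIntegral.integral_of_le hab, ← integral_Ico_eq_integral_Ioc,
      integral_eq_lintegral_of_nonneg_ae (Eventually.of_forall fun x => sq_nonneg _)
        (by fun_prop)]
  rw [e1, e2] at h1
  simpa using h1

theorem MemE2.ae_hasDerivAt {u : ℝ → ℝ} (h : MemE2 u) : ∀ᵐ x, HasDerivAt u (deriv u x) x := by
  obtain ⟨w, -, -, hd⟩ := h.exists_primitive
  exact hd.mono fun x hx => hx.differentiableAt.hasDerivAt

theorem MemD.sq_sub_le {α : ℝ} {Z : Euler} (h : MemD α Z) {a b : ℝ} (hab : a ≤ b) :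
    (Z.u b - Z.u a) ^ 2 ≤ (b - a) * (prim (acPart Z.μ) b - prim (acPart Z.μ) a) := by
  have := h.finite_μ
  have hf : IsFiniteMeasure (energyDensity Z.u) := h.ac_eq ▸ isFiniteMeasure_of_le (acPart_le Z.μ)
  rw [h.ac_eq]
  exact h.u_mem.sq_sub_le hab

theorem prim_sub_mono {μ ν : Measure ℝ} [IsFiniteMeasure ν] (h : μ ≤ ν) {a b : ℝ}
    (hab : a ≤ b) : prim μ b - prim μ a ≤ prim ν b - prim ν a := by
  have := isFiniteMeasure_of_le h
  rw [prim_sub_prim _ hab, prim_sub_prim _ hab]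
  exact ENNReal.toReal_mono (measure_ne_top _ _) (h _)

/-- The absolutely continuous part alone controls the increments of `u`, and adding the singular
part only helps. Differentiating `G` almost everywhere sees only the absolutely continuous density,
which is `u_x²`. -/
theorem MemD.compat {α : ℝ} {Z : Euler} (h : MemD α Z) : Compat Z.u Z.μ := by
  have := h.finite_μ
  refine ⟨h.finite_μ, fun a b hab => (h.sq_sub_le hab).trans ?_, ?_⟩
  · exact mul_le_mul_of_nonneg_left (prim_sub_mono (acPart_le Z.μ) hab) (sub_nonneg.2 hab)
  · have e : Z.μ.rnDeriv volume =ᵐ[volume] fun x => ENNReal.ofReal (deriv Z.u x ^ 2) :=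
      (withDensity_eq_iff_of_sigmaFinite (by fun_prop) (by fun_prop)).1 h.ac_eq
    filter_upwards [e, hasDerivAt_prim_ae Z.μ, h.u_mem.ae_hasDerivAt] with x h1 h2 h3
    rw [h1, ENNReal.toReal_ofReal (sq_nonneg _)] at h2
    exact ⟨_, h3, h2⟩

/-! ### The projected datum -/

theorem exists_half_cell {dx : ℝ} (hdx : 0 < dx) (x : ℝ) :
    ∃ k : ℤ, k * dx < x ∧ x ≤ (k + 1) * dx := by
  refine ⟨⌈x / dx⌉ - 1, ?_, ?_⟩
  · have := Int.ceil_lt_add_one (x / dx)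
    push_cast
    rw [← lt_div_iff₀ hdx]; linarith
  · have := Int.le_ceil (x / dx)
    push_cast
    rw [← div_le_iff₀ hdx]; linarith

/-- A transitive relation that holds on each closed half cell propagates along the grid, by
induction on the nodes between the two points. -/
theorem rel_of_rel_half_cell {P : ℝ → ℝ → Prop} (htr : ∀ x y z, P x y → P y z → P x z)
    {dx : ℝ} (hdx : 0 < dx)
    (h : ∀ k : ℤ, ∀ x z, k * dx ≤ x → x ≤ z → z ≤ (k + 1) * dx → P x z) {x z : ℝ} (hxz : x ≤ z) :
    P x z := by
  obtain ⟨k, hk1, hk2⟩ := exists_half_cell hdx x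
  obtain ⟨l, hl1, hl2⟩ := exists_half_cell hdx z
  rcases lt_or_ge k l with hkl | hkl
  · have hgrid : ∀ m : ℤ, k + 1 ≤ m → P ((k + 1) * dx) (m * dx) := by
      intro m hm
      induction m, hm using Int.leInduction with
      | base =>
        push_cast
        exact h k _ _ (by linarith) le_rfl le_rfl
      | succ m _ ih =>
        refine htr _ _ _ ih (h m _ _ le_rfl ?_ (by push_cast; exact le_rfl))
        push_cast; linarith
    exact htr _ _ _ (htr _ _ _ (h k _ _ hk1.le hk2 le_rfl) (hgrid l hkl)) (h l _ _ le_rfl hl1.le hl2)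
  · have : ((l : ℝ) + 1) * dx ≤ (k + 1) * dx := by
      have : (l : ℝ) ≤ k := by exact_mod_cast hkl
      gcongr
    exact h k _ _ hk1.le hxz (hl2.trans this)

theorem cell_eq {dx : ℝ} (hdx : 0 < dx) {j : ℤ} {x : ℝ} (h1 : 2 * j * dx < x)
    (h2 : x ≤ (2 * j + 2) * dx) : cell dx x = j := by
  have : ⌈x / (2 * dx)⌉ = j + 1 := by
    rw [Int.ceil_eq_iff]
    push_cast
    rw [lt_div_iff₀ (by positivity), div_le_iff₀ (by positivity)]
    constructor <;> linarith
  rw [cell, this]; ring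

theorem cell_mono {dx : ℝ} (hdx : 0 < dx) : Monotone (cell dx) := fun x y h => by
  have : x / (2 * dx) ≤ y / (2 * dx) := by gcongr
  have := Int.ceil_mono this
  simp only [cell]; omega

section Proj

variable {dx : ℝ} {ε : ℤ → ℤˣ} {Z : Euler}

theorem units_sq (e : ℤˣ) : ((e : ℤ) : ℝ) ^ 2 = 1 := by
  rcases Int.units_eq_one_or e with h | h <;> simp [h]

/-- The slope of the projected velocity on the left half of a double cell. -/
noncomputable def slopeL (dx : ℝ) (ε : ℤ → ℤˣ) (Z : Euler) (j : ℤ) : ℝ :=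
  diffQ dx Z.u j - ((ε j : ℤ) : ℝ) * slopeQ dx Z j

/-- The slope of the projected velocity on the right half of a double cell. -/
noncomputable def slopeR (dx : ℝ) (ε : ℤ → ℤˣ) (Z : Euler) (j : ℤ) : ℝ :=
  diffQ dx Z.u j + ((ε j : ℤ) : ℝ) * slopeQ dx Z j

/-- The signs cancel and the slopes average to `Du`, so the two affine pieces of the projected
velocity meet at the midpoint. -/
theorem slope_sum (hdx : 0 < dx) (j : ℤ) :
    (slopeL dx ε Z j + slopeR dx ε Z j) * dx = Z.u ((2 * j + 2) * dx) - Z.u (2 * j * dx) := by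
  simp only [slopeL, slopeR, diffQ]
  field_simp
  ring

/-- Cauchy–Schwarz over a double cell makes the radicand nonnegative, so `Real.sqrt` does not take
its default value. -/
theorem slopeQ_sq (hdx : 0 < dx) (hZ : ∀ a b, a ≤ b →
    (Z.u b - Z.u a) ^ 2 ≤ (b - a) * (prim (acPart Z.μ) b - prim (acPart Z.μ) a)) (j : ℤ) :
    slopeQ dx Z j ^ 2 = diffQ dx (prim (acPart Z.μ)) j - diffQ dx Z.u j ^ 2 := by
  rw [slopeQ, Real.sq_sqrt]
  have h := hZ (2 * j * dx) ((2 * j + 2) * dx) (by linarith)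
  rw [sub_nonneg, diffQ, diffQ, div_pow, div_le_div_iff₀ (by positivity) (by positivity)]
  nlinarith

/-- This is what `q` is chosen for: as `ε² = 1`, the mean of the squared slopes is `(Du)² + q² =
DF_ac`, so the projection keeps the absolutely continuous energy of each double cell. -/
theorem slope_sq_sum (hdx : 0 < dx) (hZ : ∀ a b, a ≤ b →
    (Z.u b - Z.u a) ^ 2 ≤ (b - a) * (prim (acPart Z.μ) b - prim (acPart Z.μ) a)) (j : ℤ) :
    (slopeL dx ε Z j ^ 2 + slopeR dx ε Z j ^ 2) * dx =
      prim (acPart Z.μ) ((2 * j + 2) * dx) - prim (acPart Z.μ) (2 * j * dx) := by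
  have h1 := slopeQ_sq hdx hZ j
  have h2 := units_sq (ε j)
  have h3 : diffQ dx (prim (acPart Z.μ)) j * (2 * dx) =
      prim (acPart Z.μ) ((2 * j + 2) * dx) - prim (acPart Z.μ) (2 * j * dx) := by
    rw [diffQ]; field_simp
  rw [← h3]
  simp only [slopeL, slopeR]
  linear_combination (2 * dx * slopeQ dx Z j ^ 2) * h2 + 2 * dx * h1

theorem projU_left (hdx : 0 < dx) {j : ℤ} {x : ℝ} (h1 : 2 * j * dx < x)
    (h2 : x ≤ (2 * j + 1) * dx) :
    projU dx ε Z x = Z.u (2 * j * dx) + slopeL dx ε Z j * (x - 2 * j * dx) := by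
  simp only [projU, cell_eq hdx h1 (by linarith), if_pos h2, slopeL]

theorem projU_right (hdx : 0 < dx) {j : ℤ} {x : ℝ} (h1 : (2 * j + 1) * dx ≤ x)
    (h2 : x ≤ (2 * j + 2) * dx) :
    projU dx ε Z x = Z.u ((2 * j + 2) * dx) + slopeR dx ε Z j * (x - (2 * j + 2) * dx) := by
  rcases h1.eq_or_lt with h | h
  · rw [projU_left hdx (j := j) (by linarith) h.ge, ← h]
    linear_combination slope_sum (ε := ε) (Z := Z) hdx j
  · simp only [projU, cell_eq hdx (j := j) (by linarith) h2, if_neg (not_le.2 h), slopeR]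

theorem projFac_left (hdx : 0 < dx) {j : ℤ} {x : ℝ} (h1 : 2 * j * dx < x)
    (h2 : x ≤ (2 * j + 1) * dx) :
    projFac dx ε Z x = prim (acPart Z.μ) (2 * j * dx) +
      slopeL dx ε Z j ^ 2 * (x - 2 * j * dx) := by
  simp only [projFac, cell_eq hdx h1 (by linarith), if_pos h2, slopeL]

theorem projFac_right (hdx : 0 < dx) (hZ : ∀ a b, a ≤ b →
    (Z.u b - Z.u a) ^ 2 ≤ (b - a) * (prim (acPart Z.μ) b - prim (acPart Z.μ) a))
    {j : ℤ} {x : ℝ} (h1 : (2 * j + 1) * dx ≤ x) (h2 : x ≤ (2 * j + 2) * dx) :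
    projFac dx ε Z x = prim (acPart Z.μ) ((2 * j + 2) * dx) +
      slopeR dx ε Z j ^ 2 * (x - (2 * j + 2) * dx) := by
  have h3 := slope_sq_sum (ε := ε) hdx hZ j
  rcases h1.eq_or_lt with h | h
  · rw [projFac_left hdx (j := j) (by linarith) h.ge, ← h]
    linear_combination h3
  · simp only [projFac, cell_eq hdx (j := j) (by linarith) h2, if_neg (not_le.2 h)]
    simp only [slopeL, slopeR] at h3 ⊢
    linear_combination (1 / 2) * h3

theorem projU_grid (hdx : 0 < dx) (j : ℤ) : projU dx ε Z (2 * j * dx) = Z.u (2 * j * dx) := by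
  -- Cells are open on the left, so the node `2 j dx` is the right end of cell `j - 1`.
  have := projU_right (ε := ε) (Z := Z) hdx (j := j - 1) (x := 2 * j * dx)
    (by push_cast; linarith) (by push_cast; linarith)
  push_cast at this
  rw [show (2 * ((j : ℝ) - 1) + 2) * dx = 2 * j * dx by ring] at this
  simpa using this

theorem projFac_grid (hdx : 0 < dx) (hZ : ∀ a b, a ≤ b →
    (Z.u b - Z.u a) ^ 2 ≤ (b - a) * (prim (acPart Z.μ) b - prim (acPart Z.μ) a)) (j : ℤ) :
    projFac dx ε Z (2 * j * dx) = prim (acPart Z.μ) (2 * j * dx) := by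
  have := projFac_right (ε := ε) hdx hZ (j := j - 1) (x := 2 * j * dx)
    (by push_cast; linarith) (by push_cast; linarith)
  push_cast at this
  rw [show (2 * ((j : ℝ) - 1) + 2) * dx = 2 * j * dx by ring] at this
  simpa using this

theorem projFsing_eq (hdx : 0 < dx) {j : ℤ} {x : ℝ} (h1 : 2 * j * dx < x)
    (h2 : x ≤ (2 * j + 2) * dx) :
    projFsing dx Z x = prim (singPart Z.μ) ((2 * j + 2) * dx) := by
  rw [projFsing, cell_eq hdx h1 h2]

theorem projFsing_grid (hdx : 0 < dx) (j : ℤ) :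
    projFsing dx Z (2 * j * dx) = prim (singPart Z.μ) (2 * j * dx) := by
  rw [projFsing_eq hdx (j := j - 1) (by push_cast; linarith) (by push_cast; linarith)]
  push_cast
  congr 1; ring

theorem projFsing_mono (hdx : 0 < dx) [IsFiniteMeasure Z.μ] : Monotone (projFsing dx Z) := by
  have : IsFiniteMeasure (singPart Z.μ) := isFiniteMeasure_of_le (Measure.singularPart_le _ _)
  intro x y h
  have h1 : (cell dx x : ℝ) ≤ cell dx y := by exact_mod_cast cell_mono hdx h
  exact prim_mono _ (by gcongr)

/-- One description for left (`k` even) and right (`k` odd) halves: velocity slope `s`, energy slope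
`s²`. The singular part is constant only away from the left end, where it may jump. -/
theorem exists_affine (hdx : 0 < dx) (hZ : ∀ a b, a ≤ b →
    (Z.u b - Z.u a) ^ 2 ≤ (b - a) * (prim (acPart Z.μ) b - prim (acPart Z.μ) a)) (k : ℤ) :
    ∃ s c d e : ℝ, (∀ x, k * dx ≤ x → x ≤ (k + 1) * dx →
      projU dx ε Z x = c + s * x ∧ projFac dx ε Z x = d + s ^ 2 * x) ∧
      ∀ x, k * dx < x → x ≤ (k + 1) * dx → projFsing dx Z x = e := by
  rcases Int.even_or_odd' k with ⟨j, rfl | rfl⟩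
  · push_cast
    refine ⟨slopeL dx ε Z j, Z.u (2 * j * dx) - slopeL dx ε Z j * (2 * j * dx),
      prim (acPart Z.μ) (2 * j * dx) - slopeL dx ε Z j ^ 2 * (2 * j * dx),
      prim (singPart Z.μ) ((2 * j + 2) * dx), fun x h1 h2 => ?_,
      fun x h1 h2 => projFsing_eq hdx h1 (by linarith)⟩
    rcases h1.eq_or_lt with h | h
    · rw [← h, projU_grid hdx, projFac_grid hdx hZ]
      constructor <;> ring
    · rw [projU_left hdx h h2, projFac_left hdx h h2]
      constructor <;> ring
  · push_cast
    refine ⟨slopeR dx ε Z j, Z.u ((2 * j + 2) * dx) - slopeR dx ε Z j * ((2 * j + 2) * dx),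
      prim (acPart Z.μ) ((2 * j + 2) * dx) - slopeR dx ε Z j ^ 2 * ((2 * j + 2) * dx),
      prim (singPart Z.μ) ((2 * j + 2) * dx), fun x h1 h2 => ?_,
      fun x h1 h2 => projFsing_eq hdx (by linarith) (by linarith)⟩
    rw [projU_right hdx h1 (by linarith), projFac_right hdx hZ h1 (by linarith)]
    constructor <;> ring

/-- The primitive of the projected measure. -/
noncomputable def projF (dx : ℝ) (ε : ℤ → ℤˣ) (Z : Euler) (x : ℝ) : ℝ :=
  projFac dx ε Z x + projFsing dx Z x

/-- On a half cell the inequality is an equality, both sides being `s² (z - x)²`. Bounds on adjacent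
intervals combine: from `A² ≤ l p` and `B² ≤ m q` follows `2 A B ≤ l q + m p`, hence `(A + B)² ≤ (l
+ m)(p + q)`. Monotonicity is carried along since the combination needs the signs of `p` and `q`. -/
theorem projU_sq_sub_le_aux (hdx : 0 < dx) (hZ : ∀ a b, a ≤ b →
    (Z.u b - Z.u a) ^ 2 ≤ (b - a) * (prim (acPart Z.μ) b - prim (acPart Z.μ) a)) {x z : ℝ}
    (hxz : x ≤ z) : projFac dx ε Z x ≤ projFac dx ε Z z ∧
      (projU dx ε Z z - projU dx ε Z x) ^ 2 ≤
        (z - x) * (projFac dx ε Z z - projFac dx ε Z x) := by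
  refine (rel_of_rel_half_cell (P := fun x z => x ≤ z ∧ projFac dx ε Z x ≤ projFac dx ε Z z ∧
      (projU dx ε Z z - projU dx ε Z x) ^ 2 ≤ (z - x) * (projFac dx ε Z z - projFac dx ε Z x))
      ?_ hdx ?_ hxz).2
  · rintro x y z ⟨h1, h2, h3⟩ ⟨h4, h5, h6⟩
    refine ⟨h1.trans h4, h2.trans h5, ?_⟩
    set A := projU dx ε Z y - projU dx ε Z x
    set B := projU dx ε Z z - projU dx ε Z y
    set p := projFac dx ε Z y - projFac dx ε Z x with hp
    set q := projFac dx ε Z z - projFac dx ε Z y with hq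
    have e1 : projU dx ε Z z - projU dx ε Z x = A + B := by ring
    have e2 : projFac dx ε Z z - projFac dx ε Z x = p + q := by ring
    have hp0 : 0 ≤ p := sub_nonneg.2 h2
    have hq0 : 0 ≤ q := sub_nonneg.2 h5
    have hl0 := sub_nonneg.2 h1
    have hm0 := sub_nonneg.2 h4
    have key : 2 * (A * B) ≤ (y - x) * q + (z - y) * p := by
      have h7 : (2 * (A * B)) ^ 2 ≤ ((y - x) * q + (z - y) * p) ^ 2 := by
        have h8 := mul_le_mul h3 h6 (sq_nonneg B) (mul_nonneg hl0 hp0)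
        nlinarith [sq_nonneg ((y - x) * q - (z - y) * p)]
      exact (le_abs_self _).trans (abs_le_of_sq_le_sq h7 (by positivity))
    rw [e1, e2]
    nlinarith
  · intro k x z h1 h2 h3
    obtain ⟨s, c, d, -, hs, -⟩ := exists_affine (ε := ε) hdx hZ k
    obtain ⟨a1, a2⟩ := hs x h1 (h2.trans h3)
    obtain ⟨a3, a4⟩ := hs z (h1.trans h2) h3
    rw [a1, a2, a3, a4]
    refine ⟨h2, ?_, le_of_eq (by ring)⟩
    gcongr

theorem projF_mono (hdx : 0 < dx) [IsFiniteMeasure Z.μ] (hZ : ∀ a b, a ≤ b →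
    (Z.u b - Z.u a) ^ 2 ≤ (b - a) * (prim (acPart Z.μ) b - prim (acPart Z.μ) a)) :
    Monotone (projF dx ε Z) := fun _ _ h =>
  add_le_add (projU_sq_sub_le_aux hdx hZ h).1 (projFsing_mono hdx h)

theorem projF_grid (hdx : 0 < dx) [IsFiniteMeasure Z.μ] (hZ : ∀ a b, a ≤ b →
    (Z.u b - Z.u a) ^ 2 ≤ (b - a) * (prim (acPart Z.μ) b - prim (acPart Z.μ) a)) (j : ℤ) :
    projF dx ε Z (2 * j * dx) = prim Z.μ (2 * j * dx) := by
  rw [projF, projFac_grid hdx hZ, projFsing_grid hdx, prim_acPart_add_singPart]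

theorem projF_le (hdx : 0 < dx) [IsFiniteMeasure Z.μ] (hZ : ∀ a b, a ≤ b →
    (Z.u b - Z.u a) ^ 2 ≤ (b - a) * (prim (acPart Z.μ) b - prim (acPart Z.μ) a)) (x : ℝ) :
    0 ≤ projF dx ε Z x ∧ projF dx ε Z x ≤ prim Z.μ (x + 2 * dx) := by
  obtain ⟨j, hj1, hj2⟩ := exists_grid hdx x
  have h1 := projF_mono (ε := ε) hdx hZ hj1
  have h2 := projF_mono (ε := ε) hdx hZ hj2
  have e := projF_grid (ε := ε) hdx hZ (j + 1)
  push_cast at e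
  rw [show 2 * ((j : ℝ) + 1) * dx = (2 * j + 2) * dx by ring] at e
  rw [projF_grid hdx hZ] at h1
  rw [e] at h2
  exact ⟨(prim_nonneg _ _).trans h1, h2.trans (prim_mono _ (by linarith))⟩

theorem tendsto_projF_nhdsLT (hdx : 0 < dx) (hZ : ∀ a b, a ≤ b →
    (Z.u b - Z.u a) ^ 2 ≤ (b - a) * (prim (acPart Z.μ) b - prim (acPart Z.μ) a)) (x : ℝ) :
    Tendsto (projF dx ε Z) (𝓝[<] x) (𝓝 (projF dx ε Z x)) := by
  obtain ⟨k, hk1, hk2⟩ := exists_half_cell hdx x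
  obtain ⟨s, c, d, e, hs, hsing⟩ := exists_affine (ε := ε) hdx hZ k
  have key : ∀ z, k * dx < z → z ≤ (k + 1) * dx → projF dx ε Z z = d + s ^ 2 * z + e :=
    fun z h1 h2 => by rw [projF, (hs z h1.le h2).2, hsing z h1 h2]
  have hc : Continuous fun z : ℝ => d + s ^ 2 * z + e := by fun_prop
  rw [key x hk1 hk2]
  refine ((hc.tendsto x).mono_left nhdsWithin_le_nhds).congr' ?_
  filter_upwards [Ioo_mem_nhdsLT hk1] with z hz
  exact (key z hz.1 (hz.2.le.trans hk2)).symm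

/-- The piecewise formula is monotone, left-continuous, bounded and null at `-∞`, so the measure
asked for by `measureOf` exists and its default `0` plays no role. -/
theorem projF_spec (hdx : 0 < dx) [IsFiniteMeasure Z.μ] (hZ : ∀ a b, a ≤ b →
    (Z.u b - Z.u a) ^ 2 ≤ (b - a) * (prim (acPart Z.μ) b - prim (acPart Z.μ) a)) :
    IsFiniteMeasure (proj dx ε Z).ν ∧ prim (proj dx ε Z).ν = projF dx ε Z := by
  refine measureOf_spec (F := projF dx ε Z) (projF_mono hdx hZ) (tendsto_projF_nhdsLT hdx hZ) ?_
    (C := total Z.μ) fun x => (projF_le hdx hZ x).2.trans (prim_le_total _ _)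
  refine squeeze_zero (fun x => (projF_le hdx hZ x).1) (fun x => (projF_le hdx hZ x).2) ?_
  exact (tendsto_prim_atBot Z.μ).comp (tendsto_atBot_add_const_right _ _ tendsto_id)

/-- Adding the monotone singular part preserves the increment bound. Off the countable grid,
velocity and primitive are affine with slopes `s` and `s²`. -/
theorem compat_proj (hdx : 0 < dx) [IsFiniteMeasure Z.μ] (hZ : ∀ a b, a ≤ b →
    (Z.u b - Z.u a) ^ 2 ≤ (b - a) * (prim (acPart Z.μ) b - prim (acPart Z.μ) a)) :
    Compat (proj dx ε Z).u (proj dx ε Z).ν := by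
  obtain ⟨hfin, hprim⟩ := projF_spec (ε := ε) hdx hZ
  refine ⟨hfin, fun a b hab => ?_, ?_⟩
  · rw [hprim]
    refine (projU_sq_sub_le_aux hdx hZ hab).2.trans
      (mul_le_mul_of_nonneg_left ?_ (sub_nonneg.2 hab))
    have := projFsing_mono (Z := Z) hdx hab
    simp only [projF]; linarith
  · rw [hprim]
    have hN : ∀ᵐ x : ℝ, x ∉ range fun k : ℤ => (k : ℝ) * dx :=
      (countable_range _).ae_notMem volume
    filter_upwards [hN] with x hx
    obtain ⟨k, hk1, hk2⟩ := exists_half_cell hdx x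
    have hk3 : x < (k + 1) * dx := by
      refine lt_of_le_of_ne hk2 fun h => hx ⟨k + 1, ?_⟩
      push_cast
      exact h.symm
    obtain ⟨s, c, d, e, hs, hsing⟩ := exists_affine (ε := ε) hdx hZ k
    have hmem := Ioo_mem_nhds hk1 hk3
    have aff : ∀ m n : ℝ, HasDerivAt (fun z : ℝ => n + m * z) m x := fun m n => by
      simpa using ((hasDerivAt_id x).const_mul m).const_add n
    refine ⟨s, (aff s c).congr_of_eventuallyEq ?_, (aff (s ^ 2) (d + e)).congr_of_eventuallyEq ?_⟩
    · filter_upwards [hmem] with z hz using (hs z hz.1.le hz.2.le).1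
    · filter_upwards [hmem] with z hz
      rw [projF, (hs z hz.1.le hz.2.le).2, hsing z hz.1 hz.2.le]
      ring

end Proj

/-! ### Application to the exact and the projected datum -/

theorem solve_eq_solution (α t : ℝ) (Z : Euler) (h : Z.μ = Z.ν) [IsFiniteMeasure Z.ν] :
    solve α t Z = solution α Z.u Z.ν t := by
  rw [solve, mapL_eq_initialLagr Z h, solution]

end HunterSaxton

open HunterSaxton in
/-- Error estimates in Eulerian coordinates for the numerical `α`-dissipative solution of the
Hunter–Saxton equation; `X t` and `Xd t` are the exact and the numerical solution in Lagrangian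
coordinates. The norms are `[0, ∞]`-valued; those on the right-hand sides are finite. -/
theorem mainTheorem8 (α : ℝ) (hα : α ∈ Set.Icc (0 : ℝ) 1)
    (Z₀ : HunterSaxton.Euler) (hZ₀ : HunterSaxton.MemD0 α Z₀)
    (dx : ℝ) (hdx : 0 < dx) (ε : ℤ → ℤˣ) (t : ℝ) (ht : 0 ≤ t)
    (X Xd : HunterSaxton.Lagr)
    (hX : X = HunterSaxton.evolve α t (HunterSaxton.mapL Z₀))
    (hXd : Xd = HunterSaxton.evolve α t (HunterSaxton.mapL (HunterSaxton.proj dx ε Z₀)))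
    (Z Zd : HunterSaxton.Euler)
    (hZ : Z = HunterSaxton.solve α t Z₀)
    (hZd : Zd = HunterSaxton.solve α t (HunterSaxton.proj dx ε Z₀)) :
    (MemLp (fun ξ => X.U ξ - Xd.U ξ) ∞ volume ∧
      MemLp (fun ξ => X.y ξ - Xd.y ξ) ∞ volume ∧
      MemLp (fun ξ => deriv X.y ξ - deriv Xd.y ξ) 2 volume) ∧
    eLpNorm (fun x => Z.u x - Zd.u x) ∞ volume ≤
      eLpNorm (fun ξ => X.U ξ - Xd.U ξ) ∞ volume +
        ENNReal.ofReal (Real.sqrt (HunterSaxton.total Z₀.μ)) *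
          eLpNorm (fun ξ => X.y ξ - Xd.y ξ) ∞ volume ^ (1 / 2 : ℝ) ∧
    eLpNorm (fun x => HunterSaxton.prim Z.ν x - HunterSaxton.prim Zd.ν x) 1 volume ≤
      ENNReal.ofReal (4 * Real.exp (t / 2) * HunterSaxton.total Z₀.ν * dx) +
        ENNReal.ofReal (2 * HunterSaxton.total Z₀.ν) *
          eLpNorm (fun ξ => X.y ξ - Xd.y ξ) ∞ volume +
        ENNReal.ofReal (Real.exp (t / 4) * HunterSaxton.total Z₀.ν ^ (3 / 2 : ℝ)) *
          eLpNorm (fun ξ => deriv X.y ξ - deriv Xd.y ξ) 2 volume := by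
  obtain ⟨hD, hμν⟩ := hZ₀
  have hfμ := hD.finite_μ
  have hfν := hD.finite_ν
  have hsq : ∀ a b, a ≤ b →
      (Z₀.u b - Z₀.u a) ^ 2 ≤ (b - a) * (prim (acPart Z₀.μ) b - prim (acPart Z₀.μ) a) :=
    fun a b hab => hD.sq_sub_le hab
  have hc : Compat Z₀.u Z₀.ν := hμν ▸ hD.compat
  have hc' : Compat (proj dx ε Z₀).u (proj dx ε Z₀).ν := compat_proj hdx hsq
  obtain ⟨hfp, hprim⟩ := projF_spec (ε := ε) hdx hsq
  have hG : ∀ j : ℤ, prim Z₀.ν (2 * j * dx) = prim (proj dx ε Z₀).ν (2 * j * dx) := fun j => by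
    rw [hprim, projF_grid hdx hsq, hμν]
  have hu : ∀ j : ℤ, Z₀.u (2 * j * dx) = (proj dx ε Z₀).u (2 * j * dx) := fun j =>
    (projU_grid hdx j).symm
  obtain ⟨C, hC⟩ := exists_bound_sub hc hc' hdx hu
  rw [mapL_eq_initialLagr Z₀ hμν] at hX
  rw [mapL_eq_initialLagr (proj dx ε Z₀) rfl] at hXd
  rw [solve_eq_solution α t Z₀ hμν] at hZ
  rw [solve_eq_solution α t (proj dx ε Z₀) rfl] at hZd
  subst hX hXd hZ hZd
  refine ⟨⟨memLp_top_velU_sub hα hc hc' hC ht, memLp_top_charY_sub hα hc hc' hC ht,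
    memLp_deriv_charY_sub hα hc hc' ht⟩, ?_, ?_⟩
  · rw [hμν]
    exact eLpNorm_solution_u_sub_le hα hc hc' ht
  -- The term with `y_ξ` is discarded: the first two already bound the `L¹` norm.
  · refine le_trans ?_ le_self_add
    refine (eLpNorm_solution_prim_sub_le hα hc hc' ht).trans ?_
    rw [add_comm]
    refine add_le_add ?_ ?_
    · refine (mul_le_mul_right (lintegral_prim_sub_le hdx hG) _).trans ?_
      rw [← ENNReal.ofReal_mul (Real.exp_pos _).le]
      exact ENNReal.ofReal_le_ofReal (le_of_eq (by ring))
    -- The comparison gives the coefficient `G_∞(0)`, weakened here to `2 G_∞(0)`.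
    · refine mul_le_mul_left (ENNReal.ofReal_le_ofReal ?_) _
      linarith [total_nonneg Z₀.ν]
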